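/- Let $\mathbb{K}$ be a field. For a simplicial complex $\Delta$ on the vertex set $\{1,\dots,n\}$ (a set of subsets closed under taking subsets), its Stanley–Reisner ideal is the ideal $I_\Delta$ of $R=\mathbb{K}[x_1,\dots,x_n]$ generated by the squarefree monomials $\prod_{i\in s}x_i$ with $s\notin\Delta$. The Betti diagram $\beta(I)=(\beta_{i,j})$ of a homogeneous ideal $I\subseteq R$ is given by its minimal graded free resolution $\cdots\to F_1\to F_0\to I\to 0$ with $F_i=\bigoplus_j R(-j)^{\beta_{i,j}}$. The diagram is pure if for each $i$ there is at most one $j$ with $\beta_{i,j}\neq 0$. If its nonzero entries are exactly $\beta_{0,c_0},\dots,\beta_{p,c_p}$, its degree type is $(c_p-c_{p-1},\dots,c_1-c_0)$. Theorem. Let $\mathbf{d}=(d_p,\dots,d_1)$ be any finite sequence of positive integers. There exist $n$ and a simplicial complex $\Delta$ on $\{1,\dots,n\}$ such that the Betti diagram $\beta(I_\Delta)$ of the Stanley–Reisner ideal $I_\Delta\subseteq\mathbb{K}[x_1,\dots,x_n]$ is pure with degree type $\mathbf{d}$. -/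

import Mathlib

namespace PureBetti

open MvPolynomial

/-- A simplicial complex on the vertex set `Fin n`: a set of subsets of the vertex set closed under
passing to subsets. Neither the empty face nor the singletons are required to be faces. -/
abbrev Complex (n : ℕ) : Type := LowerSet (Finset (Fin n))

/-- The Stanley-Reisner ideal of a simplicial complex `Δ` in `K[x_1, …, x_n]`: the ideal generated
by the squarefree monomials `∏ i ∈ s, x_i` with `s` not a face of `Δ`. -/
noncomputable def stanleyReisnerIdeal (K : Type*) [Field K] {n : ℕ} (Δ : Complex n) :
    Ideal (MvPolynomial (Fin n) K) :=
  Ideal.span {m | ∃ s : Finset (Fin n), s ∉ Δ ∧ m = ∏ i ∈ s, X i}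

/-- `f` lies in the degree `b` component of `R(-a)`, that is, in `R_{b - a}`
(which is zero if `b < a`), where `R = K[x_1, …, x_n]` has the standard grading. -/
def MemShift {K : Type*} [Field K] {n : ℕ} (a b : ℕ) (f : MvPolynomial (Fin n) K) : Prop :=
  f = 0 ∨ ∃ e : ℕ, a + e = b ∧ f.IsHomogeneous e

/-- A minimal graded free resolution
`… → F_2 → F_1 → F_0 → I → 0` of an ideal `I` of `R = K[x_1, …, x_n]` by finitely generated graded
free modules `F_i = ⨁_{g : gen i} R(-deg i g)`. The maps are given by matrices over `R` in the
standard bases and are homogeneous of degree `0`. -/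
structure MinimalResolution {K : Type*} [Field K] {n : ℕ}
    (I : Ideal (MvPolynomial (Fin n) K)) where
  /-- The index type of the homogeneous basis of `F_i`. -/
  gen : ℕ → Type
  /-- Each `F_i` is finitely generated. -/
  fin : ∀ i, Fintype (gen i)
  /-- The degrees of the basis elements. -/
  deg : ∀ i, gen i → ℕ
  /-- The images in `I` of the basis elements of `F_0`. -/
  aug : gen 0 → MvPolynomial (Fin n) K
  /-- The matrix of the differential `F_{i+1} → F_i`. -/
  diff : ∀ i, Matrix (gen i) (gen (i + 1)) (MvPolynomial (Fin n) K)
  /-- The map `F_0 → I` preserves degrees. -/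
  aug_homogeneous : ∀ g, (aug g).IsHomogeneous (deg 0 g)
  /-- The differentials preserve degrees: the image of the basis element `g` of `F_{i+1}` is
  homogeneous of degree `deg (i + 1) g` in `F_i`. -/
  diff_homogeneous : ∀ i h g, MemShift (deg i h) (deg (i + 1) g) (diff i h g)
  /-- The map `F_0 → I` is onto. -/
  span_aug : Ideal.span (Set.range aug) = I
  /-- Exactness at `F_0`. -/
  exact_zero : Function.Exact (diff 0).mulVecLin
    (Fintype.linearCombination (MvPolynomial (Fin n) K) aug)
  /-- Exactness at `F_{i+1}`. -/
  exact_succ : ∀ i, Function.Exact (diff (i + 1)).mulVecLin (diff i).mulVecLin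
  /-- Minimality: the image of `F_{i+1}` is contained in `(x_1, …, x_n) F_i`. -/
  minimal : ∀ i h g, diff i h g ∈ Ideal.span (Set.range (X : Fin n → MvPolynomial (Fin n) K))

/-- The number `β_{i,j}` of summands `R(-j)` in the `i`-th module `F_i` of the resolution. -/
noncomputable def MinimalResolution.betti {K : Type*} [Field K] {n : ℕ}
    {I : Ideal (MvPolynomial (Fin n) K)} (F : MinimalResolution I) (i j : ℕ) : ℕ :=
  Nat.card {g : F.gen i // F.deg i g = j}

/-- `β` is the Betti diagram of the ideal `I`: `β i j` is the number of summands `R(-j)` in the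
`i`-th module of a minimal graded free resolution of `I`. Minimal graded free resolutions are
unique up to isomorphism, so at most one `β` has this property. -/
def IsBettiDiagram {K : Type*} [Field K] {n : ℕ} (I : Ideal (MvPolynomial (Fin n) K))
    (β : ℕ → ℕ → ℕ) : Prop :=
  ∃ F : MinimalResolution I, ∀ i j, β i j = F.betti i j

/-- A diagram is pure if for each `i` at most one `β_{i,j}` is nonzero. -/
def IsPure (β : ℕ → ℕ → ℕ) : Prop :=
  ∀ i j j', β i j ≠ 0 → β i j' ≠ 0 → j = j'

/-- The diagram `β` has shift type `(c_p, …, c_0)`: the nonzero entries are exactly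
`β_{0,c_0}, …, β_{p,c_p}`. -/
def HasShiftType {p : ℕ} (β : ℕ → ℕ → ℕ) (c : Fin (p + 1) → ℕ) : Prop :=
  ∀ i j, β i j ≠ 0 ↔ ∃ k : Fin (p + 1), (k : ℕ) = i ∧ c k = j

/-- The diagram `β` has degree type `(d_p, …, d_1)`, where `d_{k+1}` is written `d k` for
`k = 0, …, p - 1`: its shift type `(c_p, …, c_0)` satisfies `c_{k+1} - c_k = d_{k+1}`. -/
def HasDegreeType {p : ℕ} (β : ℕ → ℕ → ℕ) (d : Fin p → ℕ) : Prop :=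
  ∃ c : Fin (p + 1) → ℕ, HasShiftType β c ∧
    ∀ k : Fin p, (c k.succ : ℤ) - (c k.castSucc : ℤ) = (d k : ℤ)

end PureBetti

/-!
# Squarefree monomial ideals with pure resolutions of any degree type

By Alexander duality and Hochster's formula the Betti numbers of a squarefree monomial ideal are
read off the links in the dual complex: if `Γ` is the set of complements of the nonfaces of `Δ`, the
`k`-th syzygies of `I_Δ` whose multidegree is the complement of `ρ` are counted by the reduced
homology of `link_Γ ρ` in degree `k - 1`. So `I_Δ` has a pure resolution with shifts `n - s k` as
soon as the homology of `link_Γ ρ` in degree `k - 1` vanishes unless `k ≤ p` and `ρ` has `s k`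
elements, and is nonzero for some `ρ` when `k = p`. This is `IsPureComplex`, and the degree type is
given by the differences `s k - s (k + 1)`.

The boundary of the `p`-simplex is pure with all differences equal to `1`. The differences are
raised one at a time by `IsPureComplex.raise`: if `s 0, …, s i` are consecutive numbers, attach to
`Γ`, for each face `τ` with at least `s i` elements, a cone with a new apex over the star of `τ` in
`Γ`. A new face `ρ ∪ {apex of τ}` has the link of `ρ` in the star of `τ`, which is a cone unless
`τ ⊆ ρ`, and is the link of `ρ` in `Γ` if `τ ⊆ ρ`. An old face `ρ` with fewer than `s i` elements
keeps the homology of its link, since only cones are glued in along cones. If an old face `ρ` has at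
least `s i` elements, the apex over `ρ` itself kills the homology of its link, and the apexes of the
smaller `τ ⊂ ρ` bring it back one degree higher. Thus `s 0, …, s i` go up by one, and the other
`s k` stay. Treating the differences in the order `p - 1, …, 0` reaches every degree type
(`exists_isPureComplex`).

The passage from homology to resolutions is done by hand. A submodule of a free module that is
graded by squarefree multidegrees is encoded as a family `ρ ↦ N ρ` of subspaces of a vector space,
and its Koszul homology at `ρ` by the complex `chains N k ρ`. A minimal system of generators exists
(`nonempty_generators`), the relations between the generators form a family of the same kind, whose
homology is that of `N` with the degree shifted by one (`Generators.exactAt_syzygies_iff`), and there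
is no generator at `ρ` if the homology of degree `0` vanishes there (`Generators.lab_ne`). Iterating
gives the resolution; its exactness over the polynomial ring is checked in each multidegree
(`Stage.exact_matrix`).
-/

namespace PureBetti

/-! ### Simplicial chains and their localization at a face -/

section Chains

variable {K E : Type*} [Field K] [AddCommGroup E] [Module K E]

/-- The sign `(-1)^m`, where `m` is the number of elements of `W` that are larger than `v`. -/
def sgn (v : ℕ) (W : Finset ℕ) : ℤ := (-1) ^ (W.filter (v < ·)).card

lemma sgn_mul_self (v : ℕ) (W : Finset ℕ) : sgn v W * sgn v W = 1 := by
  unfold sgn; rw [← pow_add, ← two_mul, pow_mul]; simp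

lemma sgn_insert_self (v : ℕ) (W : Finset ℕ) : sgn v (insert v W) = sgn v W := by
  unfold sgn; simp [Finset.filter_insert]

lemma sgn_insert_of_lt {v w : ℕ} {W : Finset ℕ} (h : v < w) (hw : w ∉ W) :
    sgn v (insert w W) = - sgn v W := by
  unfold sgn
  rw [Finset.filter_insert, if_pos h, Finset.card_insert_of_notMem (by simp [hw]), pow_succ]
  simp

lemma sgn_insert_of_gt {v w : ℕ} {W : Finset ℕ} (h : w < v) :
    sgn v (insert w W) = sgn v W := by
  unfold sgn
  rw [Finset.filter_insert, if_neg (by omega)]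

/-- The boundary of a simplicial chain with coefficients in `E`. A chain is a finitely supported
function on the finite subsets of `ℕ`; the empty set is allowed, so that the complex is
augmented. -/
noncomputable def bd : (Finset ℕ →₀ E) →+ (Finset ℕ →₀ E) :=
  Finsupp.liftAddHom fun W => ∑ w ∈ W, sgn w W • Finsupp.singleAddHom (W.erase w)

/-- The cone over a chain with apex `v`, that is, exterior multiplication by `v`. -/
noncomputable def cone (v : ℕ) : (Finset ℕ →₀ E) →+ (Finset ℕ →₀ E) :=
  Finsupp.liftAddHom fun W =>
    if v ∈ W then 0 else sgn v W • Finsupp.singleAddHom (insert v W)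

lemma bd_single (W : Finset ℕ) (e : E) :
    bd (Finsupp.single W e) = ∑ w ∈ W, sgn w W • Finsupp.single (W.erase w) e := by
  simp [bd, AddMonoidHom.finsetSum_apply]

lemma cone_single_of_mem {v : ℕ} {W : Finset ℕ} (h : v ∈ W) (e : E) :
    cone v (Finsupp.single W e) = 0 := by
  simp [cone, h]

lemma cone_single_of_notMem {v : ℕ} {W : Finset ℕ} (h : v ∉ W) (e : E) :
    cone v (Finsupp.single W e) = sgn v W • Finsupp.single (insert v W) e := by
  simp [cone, h]

lemma cone_apply (v : ℕ) (f : Finset ℕ →₀ E) (W : Finset ℕ) :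
    cone v f W = if v ∈ W then sgn v W • f (W.erase v) else 0 := by
  induction f using Finsupp.induction_linear with
  | zero => simp
  | add f g hf hg =>
    rw [map_add, Finsupp.add_apply, hf, hg]
    split_ifs <;> simp
  | single U e =>
    by_cases hU : v ∈ U
    · rw [cone_single_of_mem hU]
      split_ifs with hW
      · rw [Finsupp.single_eq_of_ne, smul_zero]; · rfl
        rintro h; rw [← h] at hU; simp at hU
      · rfl
    · rw [cone_single_of_notMem hU]
      split_ifs with hW
      · by_cases h : insert v U = W
        · subst h
          simp [hU, sgn_insert_self]
        · have h' : W.erase v ≠ U := by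
            rintro rfl; exact h (Finset.insert_erase hW)
          simp [Finsupp.single_eq_of_ne h', Finsupp.single_eq_of_ne (Ne.symm h)]
      · have : W ≠ insert v U := by rintro rfl; simp at hW
        simp [Finsupp.single_eq_of_ne this]

lemma bd_cone_single (v : ℕ) (W : Finset ℕ) (e : E) :
    bd (cone v (Finsupp.single W e)) + cone v (bd (Finsupp.single W e)) = Finsupp.single W e := by
  by_cases h : v ∈ W
  · rw [cone_single_of_mem h, map_zero, zero_add, bd_single, map_sum, Finset.sum_eq_single v]
    · rw [map_zsmul, cone_single_of_notMem (by simp), smul_smul, Finset.insert_erase h]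
      conv_lhs => enter [1, 1]; rw [← Finset.insert_erase h, sgn_insert_self]
      rw [sgn_mul_self, one_smul]
    · intro w hw hne
      rw [map_zsmul, cone_single_of_mem (by simp [h, hne.symm]), smul_zero]
    · exact fun h' => absurd h h'
  · rw [cone_single_of_notMem h, map_zsmul, bd_single, bd_single, map_sum,
      Finset.sum_insert h, smul_add, smul_smul, sgn_insert_self, sgn_mul_self, one_smul,
      Finset.erase_insert h, add_assoc, Finset.smul_sum, ← Finset.sum_add_distrib,
      Finset.sum_eq_zero, add_zero]
    intro w hw
    have hvw : v ≠ w := fun h' => h (h' ▸ hw)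
    rw [map_zsmul, cone_single_of_notMem (by simp [h]), smul_smul, smul_smul,
      Finset.erase_insert_of_ne hvw, ← add_smul]
    have key : sgn v W * sgn w (insert v W) + sgn w W * sgn v (W.erase w) = 0 := by
      conv_lhs => enter [1, 1]; rw [← Finset.insert_erase hw]
      rcases lt_or_gt_of_ne hvw with hlt | hlt
      · rw [sgn_insert_of_lt hlt (by simp), sgn_insert_of_gt hlt]; ring
      · rw [sgn_insert_of_gt hlt, sgn_insert_of_lt hlt h]; ring
    rw [key, zero_smul]

/-- The cone is a contracting homotopy for the boundary. -/
lemma bd_cone (v : ℕ) (f : Finset ℕ →₀ E) : bd (cone v f) + cone v (bd f) = f := by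
  induction f using Finsupp.induction_linear with
  | zero => simp
  | add f g hf hg =>
    simp only [map_add]
    rw [add_add_add_comm, hf, hg]
  | single W e => exact bd_cone_single v W e

lemma bd_bd (f : Finset ℕ →₀ E) : bd (bd f) = 0 := by
  induction f using Finsupp.induction_linear with
  | zero => simp
  | add f g hf hg => simp [hf, hg]
  | single W e =>
    induction W using Finset.induction_on with
    | empty => simp [bd_single]
    | insert v W hv ih =>
      have h1 : (Finsupp.single (insert v W) e : Finset ℕ →₀ E)
          = sgn v W • cone v (Finsupp.single W e) := by
        rw [cone_single_of_notMem hv, smul_smul, sgn_mul_self, one_smul]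
      have h2 := bd_cone v (Finsupp.single W e)
      have h3 := bd_cone v (bd (Finsupp.single W e))
      rw [ih, map_zero, add_zero] at h3
      have h4 : bd (bd (cone v (Finsupp.single W e))) = 0 := by
        rw [← add_right_cancel_iff (a := bd (cone v (bd (Finsupp.single W e)))), ← map_add, h2, h3,
          zero_add]
      rw [h1, map_zsmul, map_zsmul, h4, smul_zero]

/-- The part of `N (ρ ∪ W)` that can occur as coefficient of `W` in a chain of degree `k` at `ρ`. -/
def cell (N : Finset ℕ → Submodule K E) (k : ℕ) (ρ W : Finset ℕ) : Submodule K E :=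
  open Classical in if W.card = k ∧ Disjoint ρ W then N (ρ ∪ W) else ⊥

/-- The chains of degree `k` of a family `N` of subspaces, localized at `ρ`: the coefficient of a
set `W` of `k` elements disjoint from `ρ` lies in `N (ρ ∪ W)`. When `N` is `K` on the faces of a
complex and zero elsewhere, these are the simplicial chains of the link of `ρ`. -/
def chains (N : Finset ℕ → Submodule K E) (k : ℕ) (ρ : Finset ℕ) :
    Submodule K (Finset ℕ →₀ E) where
  carrier := {f | ∀ W, f W ∈ cell N k ρ W}
  zero_mem' _ := zero_mem _
  add_mem' hf hg W := add_mem (hf W) (hg W)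
  smul_mem' c _ hf W := Submodule.smul_mem _ c (hf W)

/-- Exactness of the complex of chains of `N` at `ρ` in degree `k`: the Koszul homology of `N` in
degree `k` vanishes at `ρ`. -/
def ExactAt (N : Finset ℕ → Submodule K E) (k : ℕ) (ρ : Finset ℕ) : Prop :=
  ∀ f ∈ chains N k ρ, bd f = 0 → ∃ g ∈ chains N (k + 1) ρ, bd g = f

lemma mem_cell {N : Finset ℕ → Submodule K E} {k : ℕ} {ρ W : Finset ℕ} {e : E} :
    e ∈ cell N k ρ W ↔ e = 0 ∨ (W.card = k ∧ Disjoint ρ W ∧ e ∈ N (ρ ∪ W)) := by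
  unfold cell
  split_ifs with h
  · constructor
    · exact fun he => Or.inr ⟨h.1, h.2, he⟩
    · rintro (rfl | he)
      · exact zero_mem _
      · exact he.2.2
  · rw [Submodule.mem_bot]
    exact ⟨Or.inl, fun he => he.resolve_right fun h' => h ⟨h'.1, h'.2.1⟩⟩

lemma mem_chains {N : Finset ℕ → Submodule K E} {k : ℕ} {ρ : Finset ℕ} {f : Finset ℕ →₀ E} :
    f ∈ chains N k ρ ↔ ∀ W, f W ≠ 0 → W.card = k ∧ Disjoint ρ W ∧ f W ∈ N (ρ ∪ W) := by
  refine forall_congr' fun W => ?_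
  rw [mem_cell, or_iff_not_imp_left]

lemma single_mem_chains {N : Finset ℕ → Submodule K E} {k : ℕ} {ρ W : Finset ℕ} {e : E}
    (h1 : W.card = k) (h2 : Disjoint ρ W) (h3 : e ∈ N (ρ ∪ W)) :
    Finsupp.single W e ∈ chains N k ρ := by
  intro U
  rw [mem_cell]
  by_cases h : W = U
  · subst h; right; simpa using ⟨h1, h2, h3⟩
  · left; simp [h]

/-- An additive map takes chains into a subspace as soon as it does so for multiples of simplices. -/
lemma map_chains_mem {F : Type*} [AddCommGroup F] [Module K F] {N : Finset ℕ → Submodule K E}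
    {k : ℕ} {ρ : Finset ℕ} (T : (Finset ℕ →₀ E) →+ F) (P : Submodule K F)
    (h : ∀ W e, W.card = k → Disjoint ρ W → e ∈ N (ρ ∪ W) → T (Finsupp.single W e) ∈ P)
    {f : Finset ℕ →₀ E} (hf : f ∈ chains N k ρ) : T f ∈ P := by
  rw [← Finsupp.sum_single f, Finsupp.sum, map_sum]
  refine Submodule.sum_mem _ fun W hW => ?_
  obtain ⟨h1, h2, h3⟩ := mem_chains.1 hf W (by simpa using hW)
  exact h W _ h1 h2 h3

/-- Induction on chains, from multiples of simplices. -/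
lemma chains_induction {N : Finset ℕ → Submodule K E} {k : ℕ} {ρ : Finset ℕ}
    {p : (Finset ℕ →₀ E) → Prop} (h0 : p 0) (hadd : ∀ f g, p f → p g → p (f + g))
    (h : ∀ W e, W.card = k → Disjoint ρ W → e ∈ N (ρ ∪ W) → p (Finsupp.single W e))
    {f : Finset ℕ →₀ E} (hf : f ∈ chains N k ρ) : p f := by
  rw [← Finsupp.sum_single f, Finsupp.sum]
  refine Finset.sum_induction _ p hadd h0 fun W hW => ?_
  obtain ⟨h1, h2, h3⟩ := mem_chains.1 hf W (by simpa using hW)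
  exact h W _ h1 h2 h3

lemma bd_mem_chains {N : Finset ℕ → Submodule K E} (hN : Antitone N) {k : ℕ} {ρ : Finset ℕ}
    {f : Finset ℕ →₀ E} (hf : f ∈ chains N (k + 1) ρ) : bd f ∈ chains N k ρ := by
  refine map_chains_mem bd _ (fun W e h1 h2 h3 => ?_) hf
  rw [bd_single]
  refine Submodule.sum_mem _ fun w hw => zsmul_mem (single_mem_chains ?_ ?_ ?_) _
  · rw [Finset.card_erase_of_mem hw, h1]; rfl
  · exact h2.mono_right (Finset.erase_subset _ _)
  · exact hN (Finset.union_subset_union_right (Finset.erase_subset _ _)) h3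

lemma bd_eq_zero_of_mem_chains_zero {N : Finset ℕ → Submodule K E} {ρ : Finset ℕ}
    {f : Finset ℕ →₀ E} (hf : f ∈ chains N 0 ρ) : bd f = 0 := by
  rw [← Submodule.mem_bot K]
  refine map_chains_mem bd _ (fun W e h1 h2 h3 => ?_) hf
  rw [Finset.card_eq_zero.1 h1]
  simp [bd_single]

/-- If coning with `v` preserves the family `N` above `ρ`, its chains at `ρ` are contractible. -/
lemma exactAt_of_cone {N : Finset ℕ → Submodule K E} {k v : ℕ} {ρ : Finset ℕ} (hv : v ∉ ρ)
    (h : ∀ W, W.card = k → Disjoint ρ W → v ∉ W → N (ρ ∪ W) ≤ N (ρ ∪ insert v W)) :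
    ExactAt N k ρ := by
  intro f hf hbd
  refine ⟨cone v f, ?_, by simpa [hbd] using bd_cone v f⟩
  refine map_chains_mem (cone v) _ (fun W e h1 h2 h3 => ?_) hf
  by_cases hW : v ∈ W
  · rw [cone_single_of_mem hW]; exact zero_mem _
  · rw [cone_single_of_notMem hW]
    refine zsmul_mem (single_mem_chains ?_ ?_ (h W h1 h2 hW h3)) _
    · rw [Finset.card_insert_of_notMem hW, h1]
    · rw [Finset.disjoint_insert_right]; exact ⟨hv, h2⟩

/-- Exactness at `ρ` depends only on the family above `ρ`. -/
lemma ExactAt.congr {N N' : Finset ℕ → Submodule K E} {k : ℕ} {ρ : Finset ℕ} (hE : ExactAt N k ρ)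
    (h : ∀ W, Disjoint ρ W → N (ρ ∪ W) = N' (ρ ∪ W)) : ExactAt N' k ρ := by
  have key : ∀ j, chains N j ρ = chains N' j ρ := by
    intro j
    ext f
    rw [mem_chains, mem_chains]
    refine forall_congr' fun W => imp_congr_right fun _ => and_congr_right fun _ =>
      and_congr_right fun hd => ?_
    rw [h W hd]
  intro f hf
  rw [← key] at hf ⊢
  exact hE f hf

end Chains

/-! ### Attaching one cone -/

section Faces

variable (K E : Type*) [Field K] [AddCommGroup E] [Module K E]

/-- The family of subspaces that is everything on the members of `Γ` and zero elsewhere. -/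
noncomputable def faceFamily (Γ : Set (Finset ℕ)) (σ : Finset ℕ) : Submodule K E :=
  open Classical in if σ ∈ Γ then ⊤ else ⊥

variable {K E}

lemma faceFamily_of_mem {Γ : Set (Finset ℕ)} {σ : Finset ℕ} (h : σ ∈ Γ) :
    faceFamily K E Γ σ = ⊤ := if_pos h

lemma faceFamily_of_notMem {Γ : Set (Finset ℕ)} {σ : Finset ℕ} (h : σ ∉ Γ) :
    faceFamily K E Γ σ = ⊥ := if_neg h

lemma mem_faceFamily {Γ : Set (Finset ℕ)} {σ : Finset ℕ} {e : E} :
    e ∈ faceFamily K E Γ σ ↔ e = 0 ∨ σ ∈ Γ := by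
  by_cases h : σ ∈ Γ
  · simp [faceFamily_of_mem h, h]
  · simp [faceFamily_of_notMem h, h]

lemma faceFamily_antitone {Γ : Set (Finset ℕ)} (hΓ : IsLowerSet Γ) :
    Antitone (faceFamily K E Γ) := by
  intro σ τ h e he
  rw [mem_faceFamily] at he ⊢
  exact he.imp_right fun h' => hΓ h h'

lemma faceFamily_le {Γ : Set (Finset ℕ)} {σ τ : Finset ℕ} (h : σ ∈ Γ → τ ∈ Γ) :
    faceFamily K E Γ σ ≤ faceFamily K E Γ τ := by
  intro e he
  rw [mem_faceFamily] at he ⊢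
  exact he.imp_right h

lemma faceFamily_congr {Γ Λ : Set (Finset ℕ)} {σ τ : Finset ℕ} (h : σ ∈ Γ ↔ τ ∈ Λ) :
    faceFamily K E Γ σ = faceFamily K E Λ τ := by
  ext e
  rw [mem_faceFamily, mem_faceFamily, h]

lemma mem_chains_faceFamily {Γ : Set (Finset ℕ)} {k : ℕ} {ρ : Finset ℕ} {f : Finset ℕ →₀ E} :
    f ∈ chains (faceFamily K E Γ) k ρ ↔ ∀ W, f W ≠ 0 → W.card = k ∧ Disjoint ρ W ∧ ρ ∪ W ∈ Γ := by
  rw [mem_chains]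
  refine forall_congr' fun W => imp_congr_right fun h => ?_
  rw [mem_faceFamily]
  simp [h]

lemma exactAt_of_notMem {Γ : Set (Finset ℕ)} (hΓ : IsLowerSet Γ) {k : ℕ} {ρ : Finset ℕ}
    (h : ρ ∉ Γ) : ExactAt (faceFamily K E Γ) k ρ := by
  intro f hf _
  refine ⟨0, zero_mem _, ?_⟩
  rw [map_zero]
  ext W
  by_contra hW
  exact h (hΓ Finset.subset_union_left (mem_chains_faceFamily.1 hf W (Ne.symm hW)).2.2)

/-- The complex `Γ ∪ v * Λ`, obtained from `Γ` by attaching a cone with apex `v` over `Λ`. -/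
def attachCone (Γ : Set (Finset ℕ)) (v : ℕ) (Λ : Set (Finset ℕ)) : Set (Finset ℕ) :=
  Γ ∪ {ρ | v ∈ ρ ∧ ρ.erase v ∈ Λ}

/-- The decomposition of a chain into a part without `v` and a cone over such a part is unique. -/
lemma add_cone_eq_zero {v : ℕ} {f g : Finset ℕ →₀ E} (hf : ∀ W, f W ≠ 0 → v ∉ W)
    (hg : ∀ W, g W ≠ 0 → v ∉ W) (h : f + cone v g = 0) : f = 0 ∧ g = 0 := by
  have hf0 : f = 0 := by
    ext W
    by_contra hW
    have := DFunLike.congr_fun h W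
    rw [Finsupp.add_apply, cone_apply, if_neg (hf W hW), add_zero] at this
    exact hW this
  refine ⟨hf0, ?_⟩
  rw [hf0, zero_add] at h
  ext W
  by_contra hW
  have := DFunLike.congr_fun h (insert v W)
  rw [cone_apply, if_pos (Finset.mem_insert_self _ _), Finset.erase_insert (hg W hW)] at this
  have h2 : sgn v (insert v W) • (sgn v (insert v W) • g W) = 0 := by rw [this]; simp
  rw [smul_smul, sgn_mul_self, one_smul] at h2
  exact hW h2

section Attach

variable {Γ Λ : Set (Finset ℕ)} {v : ℕ} {ρ : Finset ℕ}

lemma not_mem_of_mem_chains (hv : ∀ σ ∈ Γ, v ∉ σ) {k : ℕ} {f : Finset ℕ →₀ E}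
    (hf : f ∈ chains (faceFamily K E Γ) k ρ) : ∀ W, f W ≠ 0 → v ∉ W := fun W hW hvW =>
  hv _ (mem_chains_faceFamily.1 hf W hW).2.2 (Finset.mem_union_right _ hvW)

lemma chains_faceFamily_mono (h : Λ ⊆ Γ) (k : ℕ) :
    chains (faceFamily K E Λ) k ρ ≤ chains (faceFamily K E Γ) k ρ := by
  intro f hf
  rw [mem_chains_faceFamily] at hf ⊢
  exact fun W hW => ⟨(hf W hW).1, (hf W hW).2.1, h (hf W hW).2.2⟩

lemma cone_mem_chains_attachCone (hvρ : v ∉ ρ) {k : ℕ}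
    {f : Finset ℕ →₀ E} (hf : f ∈ chains (faceFamily K E Λ) k ρ) :
    cone v f ∈ chains (faceFamily K E (attachCone Γ v Λ)) (k + 1) ρ := by
  rw [mem_chains_faceFamily] at hf ⊢
  intro W hW
  rw [cone_apply] at hW
  split_ifs at hW with hvW
  · obtain ⟨h1, h2, h3⟩ := hf (W.erase v) (fun h => hW (by rw [h, smul_zero]))
    refine ⟨?_, ?_, Or.inr ⟨Finset.mem_union_right _ hvW, ?_⟩⟩
    · rw [← h1, Finset.card_erase_add_one hvW]
    · rw [← Finset.insert_erase hvW, Finset.disjoint_insert_right]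
      exact ⟨hvρ, h2⟩
    · rw [Finset.erase_union_distrib, Finset.erase_eq_of_notMem hvρ]
      exact h3
  · exact absurd rfl hW

lemma exists_eq_add_cone (hvρ : v ∉ ρ) {k : ℕ} {f : Finset ℕ →₀ E}
    (hf : f ∈ chains (faceFamily K E (attachCone Γ v Λ)) (k + 1) ρ) :
    ∃ f₀ ∈ chains (faceFamily K E Γ) (k + 1) ρ, ∃ f₁ ∈ chains (faceFamily K E Λ) k ρ,
      f = f₀ + cone v f₁ := by
  refine chains_induction (p := fun f => ∃ f₀ ∈ chains (faceFamily K E Γ) (k + 1) ρ,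
    ∃ f₁ ∈ chains (faceFamily K E Λ) k ρ, f = f₀ + cone v f₁) ?_ ?_ ?_ hf
  · exact ⟨0, zero_mem _, 0, zero_mem _, by simp⟩
  · rintro _ _ ⟨f₀, h₀, f₁, h₁, rfl⟩ ⟨g₀, h₀', g₁, h₁', rfl⟩
    exact ⟨f₀ + g₀, add_mem h₀ h₀', f₁ + g₁, add_mem h₁ h₁', by rw [map_add]; abel⟩
  · intro W e h1 h2 h3
    rcases mem_faceFamily.1 h3 with rfl | h | ⟨hv, h⟩
    · exact ⟨0, zero_mem _, 0, zero_mem _, by simp⟩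
    · exact ⟨Finsupp.single W e, single_mem_chains h1 h2 (mem_faceFamily.2 (Or.inr h)), 0,
        zero_mem _, by simp⟩
    · have hvW : v ∈ W := (Finset.mem_union.1 hv).resolve_left hvρ
      rw [Finset.erase_union_distrib, Finset.erase_eq_of_notMem hvρ] at h
      refine ⟨0, zero_mem _, sgn v (W.erase v) • Finsupp.single (W.erase v) e,
        zsmul_mem (single_mem_chains ?_ ?_ (mem_faceFamily.2 (Or.inr h))) _, ?_⟩
      · rw [Finset.card_erase_of_mem hvW, h1]; rfl
      · exact h2.mono_right (Finset.erase_subset _ _)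
      · rw [map_zsmul, cone_single_of_notMem (by simp), smul_smul, sgn_mul_self, one_smul,
          Finset.insert_erase hvW, zero_add]

/-- If the cycles of degree `k` of `Γ` and those of degree `k - 1` of `Λ ⊆ Γ` are boundaries
at `ρ`, then so are the cycles of degree `k` of `Γ ∪ v * Λ`. -/
lemma ExactAt.attachCone (hΓ : IsLowerSet Γ) (hΛ : IsLowerSet Λ) (hΛΓ : Λ ⊆ Γ)
    (hv : ∀ σ ∈ Γ, v ∉ σ) (hvρ : v ∉ ρ) {k : ℕ} (h : ExactAt (faceFamily K E Γ) k ρ)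
    (h' : ∀ j, k = j + 1 → ExactAt (faceFamily K E Λ) j ρ) :
    ExactAt (faceFamily K E (attachCone Γ v Λ)) k ρ := by
  intro f hf hbd
  have hle : ∀ k, chains (faceFamily K E Γ) k ρ
      ≤ chains (faceFamily K E (PureBetti.attachCone Γ v Λ)) k ρ :=
    fun k => chains_faceFamily_mono Set.subset_union_left k
  have hvΛ : ∀ σ ∈ Λ, v ∉ σ := fun σ hσ => hv σ (hΛΓ hσ)
  cases k with
  | zero =>
    have hf' : f ∈ chains (faceFamily K E Γ) 0 ρ := by
      rw [mem_chains_faceFamily] at hf ⊢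
      intro W hW
      obtain ⟨h1, h2, h3⟩ := hf W hW
      refine ⟨h1, h2, h3.resolve_right fun h4 => ?_⟩
      rw [Finset.card_eq_zero.1 h1, Finset.union_empty] at h4
      exact hvρ h4.1
    obtain ⟨g, hg, rfl⟩ := h f hf' hbd
    exact ⟨g, hle _ hg, rfl⟩
  | succ j =>
    obtain ⟨f₀, h₀, f₁, h₁, rfl⟩ := exists_eq_add_cone hvρ hf
    have hc := eq_sub_of_add_eq (bd_cone v f₁)
    have hb1 : ∀ W, (bd f₁) W ≠ 0 → v ∉ W := by
      cases j with
      | zero => rw [bd_eq_zero_of_mem_chains_zero h₁]; simp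
      | succ i => exact not_mem_of_mem_chains hvΛ (bd_mem_chains (faceFamily_antitone hΛ) h₁)
    have hb0 : bd f₀ + f₁ ∈ chains (faceFamily K E Γ) j ρ :=
      add_mem (bd_mem_chains (faceFamily_antitone hΓ) h₀) (chains_faceFamily_mono hΛΓ _ h₁)
    have hsum : (bd f₀ + f₁) + cone v (-(bd f₁)) = 0 := by
      rw [map_neg, ← hbd, map_add, hc]
      abel
    obtain ⟨e0, e1⟩ := add_cone_eq_zero (not_mem_of_mem_chains hv hb0) (by simpa using hb1) hsum
    obtain ⟨g, hg, rfl⟩ := h' j rfl f₁ h₁ (by simpa using e1)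
    obtain ⟨q, hq, hq'⟩ := h (f₀ + g) (add_mem h₀ (chains_faceFamily_mono hΛΓ _ hg))
      (by rw [map_add, e0])
    refine ⟨q - cone v g, sub_mem (hle _ hq) (cone_mem_chains_attachCone hvρ hg), ?_⟩
    rw [map_sub, hq', eq_sub_of_add_eq (bd_cone v g)]
    abel

/-- If the cycles of degree `k` of `Γ ∪ v * Λ` and of `Λ ⊆ Γ` are boundaries at `ρ`, then so are
those of `Γ`. -/
lemma ExactAt.of_attachCone (hΓ : IsLowerSet Γ) (hΛ : IsLowerSet Λ) (hΛΓ : Λ ⊆ Γ)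
    (hv : ∀ σ ∈ Γ, v ∉ σ) (hvρ : v ∉ ρ) {k : ℕ}
    (h : ExactAt (faceFamily K E (PureBetti.attachCone Γ v Λ)) k ρ)
    (h' : ExactAt (faceFamily K E Λ) k ρ) : ExactAt (faceFamily K E Γ) k ρ := by
  intro f hf hbd
  have hvΛ : ∀ σ ∈ Λ, v ∉ σ := fun σ hσ => hv σ (hΛΓ hσ)
  obtain ⟨g, hg, hgf⟩ := h f (chains_faceFamily_mono Set.subset_union_left k hf) hbd
  obtain ⟨g₀, h₀, g₁, h₁, rfl⟩ := exists_eq_add_cone hvρ hg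
  have hc := eq_sub_of_add_eq (bd_cone v g₁)
  have hb1 : ∀ W, (bd g₁) W ≠ 0 → v ∉ W := by
    cases k with
    | zero => rw [bd_eq_zero_of_mem_chains_zero h₁]; simp
    | succ i => exact not_mem_of_mem_chains hvΛ (bd_mem_chains (faceFamily_antitone hΛ) h₁)
  have hb0 : bd g₀ + g₁ - f ∈ chains (faceFamily K E Γ) k ρ :=
    sub_mem (add_mem (bd_mem_chains (faceFamily_antitone hΓ) h₀)
      (chains_faceFamily_mono hΛΓ _ h₁)) hf
  have hsum : (bd g₀ + g₁ - f) + cone v (-(bd g₁)) = 0 := by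
    rw [map_neg, ← hgf, map_add, hc]
    abel
  obtain ⟨e0, e1⟩ := add_cone_eq_zero (not_mem_of_mem_chains hv hb0) (by simpa using hb1) hsum
  obtain ⟨q, hq, rfl⟩ := h' g₁ h₁ (by simpa using e1)
  refine ⟨g₀ + q, add_mem h₀ (chains_faceFamily_mono hΛΓ _ hq), ?_⟩
  rw [map_add]
  exact sub_eq_zero.1 e0

end Attach

end Faces

/-! ### Pure complexes of any degree type -/

section Construction

variable {K E : Type*} [Field K] [AddCommGroup E] [Module K E]

/-- The star of `τ` in `Γ`. -/
def star (Γ : Set (Finset ℕ)) (τ : Finset ℕ) : Set (Finset ℕ) := {σ | σ ∪ τ ∈ Γ}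

lemma star_isLowerSet {Γ : Set (Finset ℕ)} (hΓ : IsLowerSet Γ) (τ : Finset ℕ) :
    IsLowerSet (star Γ τ) := fun _ _ h h' => hΓ (Finset.union_subset_union_left h) h'

lemma star_subset {Γ : Set (Finset ℕ)} (hΓ : IsLowerSet Γ) (τ : Finset ℕ) : star Γ τ ⊆ Γ :=
  fun _ h => hΓ Finset.subset_union_left h

/-- The star of `τ` is a cone over the link of `ρ` if `ρ` does not contain `τ`. -/
lemma exactAt_star_of_not_subset {Γ : Set (Finset ℕ)} {τ ρ : Finset ℕ} (k : ℕ)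
    (h : ¬ τ ⊆ ρ) : ExactAt (faceFamily K E (star Γ τ)) k ρ := by
  obtain ⟨x, hx, hxρ⟩ := Finset.not_subset.1 h
  refine exactAt_of_cone hxρ fun W _ _ _ => faceFamily_le fun hW => ?_
  change ρ ∪ insert x W ∪ τ ∈ Γ
  rwa [show ρ ∪ insert x W ∪ τ = ρ ∪ W ∪ τ by
    ext y; simp only [Finset.mem_union, Finset.mem_insert]
    constructor
    · rintro ((h | rfl | h) | h) <;> simp_all
    · rintro ((h | h) | h) <;> simp_all]

lemma exactAt_star_of_subset {Γ : Set (Finset ℕ)} {τ ρ : Finset ℕ} {k : ℕ}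
    (h : τ ⊆ ρ) (hE : ExactAt (faceFamily K E Γ) k ρ) :
    ExactAt (faceFamily K E (star Γ τ)) k ρ := by
  refine hE.congr fun W _ => faceFamily_congr ?_
  change _ ↔ ρ ∪ W ∪ τ ∈ Γ
  rw [Finset.union_eq_left.2 (h.trans Finset.subset_union_left)]

/-- The complex obtained from `Γ` by attaching, for each `τ ∈ T`, a cone with apex `u τ` over the
star of `τ`. -/
def attachStars (Γ : Set (Finset ℕ)) (u : Finset ℕ → ℕ) (T : Set (Finset ℕ)) :
    Set (Finset ℕ) :=
  Γ ∪ {ρ | ∃ τ ∈ T, u τ ∈ ρ ∧ ρ.erase (u τ) ∈ star Γ τ}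

variable {Γ : Set (Finset ℕ)} {u : Finset ℕ → ℕ} {T : Set (Finset ℕ)}

lemma attachStars_insert (τ : Finset ℕ) :
    attachStars Γ u (insert τ T) = attachCone (attachStars Γ u T) (u τ) (star Γ τ) := by
  ext ρ
  simp only [attachStars, attachCone, Set.mem_union, Set.mem_ofPred_eq, Set.mem_insert_iff,
    exists_eq_or_imp]
  rw [or_assoc]
  exact or_congr_right or_comm

lemma attachStars_isLowerSet (hΓ : IsLowerSet Γ) : IsLowerSet (attachStars Γ u T) := by
  rintro σ ρ h (h' | ⟨τ, hτ, hu, h'⟩)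
  · exact Or.inl (hΓ h h')
  · by_cases hu' : u τ ∈ ρ
    · exact Or.inr ⟨τ, hτ, hu', star_isLowerSet hΓ τ (Finset.erase_subset_erase _ h) h'⟩
    · refine Or.inl (star_subset hΓ τ (star_isLowerSet hΓ τ ?_ h'))
      exact Finset.subset_erase.2 ⟨h, hu'⟩

lemma apex_notMem_of_mem_attachStars (hΓ : IsLowerSet Γ) (hu : Function.Injective u)
    (hfresh : ∀ τ, ∀ σ ∈ Γ, u τ ∉ σ) {τ : Finset ℕ} (hτ : τ ∉ T) :
    ∀ σ ∈ attachStars Γ u T, u τ ∉ σ := by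
  rintro σ (h | ⟨τ', hτ', hu', h⟩) hmem
  · exact hfresh τ σ h hmem
  · have hne : u τ ≠ u τ' := fun h => hτ (hu h ▸ hτ')
    exact hfresh τ _ (star_subset hΓ _ h) (Finset.mem_erase.2 ⟨hne, hmem⟩)

/-- Attaching cones over stars preserves exactness at a face where the stars are exact. -/
lemma exactAt_attachStars (hΓ : IsLowerSet Γ) (hu : Function.Injective u)
    (hfresh : ∀ τ, ∀ σ ∈ Γ, u τ ∉ σ) {ρ : Finset ℕ} (hρ : ρ ∈ Γ) {k : ℕ} (hT : T.Finite)
    {T₀ : Set (Finset ℕ)} (h₀ : T₀ ⊆ T)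
    (h : ExactAt (faceFamily K E (attachStars Γ u T₀)) k ρ)
    (h' : ∀ τ ∈ T, τ ∉ T₀ → ∀ j, k = j + 1 → ExactAt (faceFamily K E (star Γ τ)) j ρ) :
    ExactAt (faceFamily K E (attachStars Γ u T)) k ρ := by
  have key : ∀ S : Set (Finset ℕ), S.Finite → S ⊆ T \ T₀ →
      ExactAt (faceFamily K E (attachStars Γ u (S ∪ T₀))) k ρ := by
    intro S hS
    induction S, hS using Set.Finite.induction_on with
    | empty => intro _; simpa using h
    | @insert τ S hτ hS ih =>
      intro hsub
      have hτT := hsub (Set.mem_insert _ _)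
      rw [Set.insert_union, attachStars_insert]
      refine ExactAt.attachCone (attachStars_isLowerSet hΓ) (star_isLowerSet hΓ _)
        ((star_subset hΓ _).trans Set.subset_union_left)
        (apex_notMem_of_mem_attachStars hΓ hu hfresh ?_) (hfresh _ _ hρ)
        (ih ((Set.subset_insert _ _).trans hsub)) (h' τ hτT.1 hτT.2)
      exact fun h => h.elim hτ hτT.2
  have := key _ (hT.subset Set.sdiff_subset) subset_rfl
  rwa [Set.sdiff_union_of_subset h₀] at this

/-- Exactness descends along the attaching of cones over stars that are exact. -/
lemma exactAt_of_attachStars (hΓ : IsLowerSet Γ) (hu : Function.Injective u)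
    (hfresh : ∀ τ, ∀ σ ∈ Γ, u τ ∉ σ) {ρ : Finset ℕ} (hρ : ρ ∈ Γ) {k : ℕ} (hT : T.Finite)
    (h : ExactAt (faceFamily K E (attachStars Γ u T)) k ρ)
    (h' : ∀ τ ∈ T, ExactAt (faceFamily K E (star Γ τ)) k ρ) :
    ExactAt (faceFamily K E Γ) k ρ := by
  induction T, hT using Set.Finite.induction_on with
  | empty => simpa [attachStars] using h
  | @insert τ T hτ hT ih =>
    rw [attachStars_insert] at h
    refine ih (ExactAt.of_attachCone (attachStars_isLowerSet hΓ) (star_isLowerSet hΓ _)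
      ((star_subset hΓ _).trans Set.subset_union_left)
      (apex_notMem_of_mem_attachStars hΓ hu hfresh hτ) (hfresh _ _ hρ) h
      (h' τ (Set.mem_insert _ _))) fun τ' h'' => h' τ' (Set.mem_insert_of_mem _ h'')

variable (K E) in
/-- A finite simplicial complex `Γ` on vertices in `ℕ` is pure of type `(p, s)` if the reduced
homology of the link of a face `ρ` vanishes in degree `k - 1` unless `k ≤ p` and `ρ` has `s k`
elements, and if the link of some face has homology in degree `p - 1`. -/
structure IsPureComplex (Γ : Set (Finset ℕ)) (p : ℕ) (s : ℕ → ℕ) : Prop where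
  isLowerSet : IsLowerSet Γ
  bounded : ∃ n, ∀ σ ∈ Γ, σ ⊆ Finset.range n
  exactAt : ∀ k ρ, ¬ (k ≤ p ∧ ρ.card = s k) → ExactAt (faceFamily K E Γ) k ρ
  not_exactAt : ∃ ρ, ¬ ExactAt (faceFamily K E Γ) p ρ

/-- The boundary of the `p`-simplex is pure of type `(p, k ↦ p - k)`. -/
lemma isPureComplex_boundary [Nontrivial E] (p : ℕ) :
    IsPureComplex K E {σ | σ ⊂ Finset.range (p + 1)} p (fun k => p - k) where
  isLowerSet := fun _ _ h h' => lt_of_le_of_lt h h'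
  bounded := ⟨p + 1, fun _ h => h.1⟩
  exactAt := by
    intro k ρ h
    have hne : k + ρ.card ≠ p := by omega
    by_cases hρ : ρ ⊂ Finset.range (p + 1)
    · obtain ⟨v, hv, hvρ⟩ := Finset.exists_of_ssubset hρ
      refine exactAt_of_cone hvρ fun W h1 h2 h3 => faceFamily_le fun hW => ?_
      have hc := Finset.card_lt_card hW
      rw [Finset.card_union_of_disjoint h2, Finset.card_range] at hc
      refine (Finset.ssubset_iff_subset_ne).2 ⟨?_, fun heq => ?_⟩
      · rw [Finset.union_insert, Finset.insert_subset_iff]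
        exact ⟨hv, hW.1⟩
      · have := congrArg Finset.card heq
        rw [Finset.card_union_of_disjoint (by
          rw [Finset.disjoint_insert_right]; exact ⟨hvρ, h2⟩),
          Finset.card_insert_of_notMem h3, Finset.card_range] at this
        omega
    · exact exactAt_of_notMem (fun _ _ h h' => lt_of_le_of_lt h h') hρ
  not_exactAt := by
    obtain ⟨e, he⟩ := exists_ne (0 : E)
    refine ⟨∅, fun h => ?_⟩
    have hmem : bd (Finsupp.single (Finset.range (p + 1)) e)
        ∈ chains (faceFamily K E {σ | σ ⊂ Finset.range (p + 1)}) p ∅ := by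
      rw [bd_single]
      refine Submodule.sum_mem _ fun w hw => zsmul_mem (single_mem_chains ?_ ?_ ?_) _
      · rw [Finset.card_erase_of_mem hw, Finset.card_range]; rfl
      · exact Finset.disjoint_empty_left _
      · rw [Finset.empty_union]
        exact mem_faceFamily.2 (Or.inr (Finset.erase_ssubset hw))
    obtain ⟨g, hg, hgb⟩ := h _ hmem (bd_bd _)
    have hg0 : g = 0 := by
      ext W
      by_contra hW
      obtain ⟨h1, -, h3⟩ := mem_chains_faceFamily.1 hg W hW
      have := Finset.card_lt_card h3
      rw [Finset.empty_union, h1, Finset.card_range] at this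
      omega
    have h2 := bd_cone 0 (Finsupp.single (Finset.range (p + 1)) e)
    rw [cone_single_of_mem (by simp), ← hgb, hg0] at h2
    simp only [map_zero, add_zero] at h2
    exact he (by simpa using (Finsupp.single_eq_zero.1 h2.symm))

/-- If the shifts `s 0, …, s (i - 1)` are consecutive, they can all be raised by one, leaving the
other ones as they are: attach a cone over the star of each face with at least `s (i - 1)`
elements. -/
lemma IsPureComplex.raise {Γ : Set (Finset ℕ)} {p : ℕ} {s : ℕ → ℕ}
    (h : IsPureComplex K E Γ p s) {i : ℕ} (hi : i < p)
    (hlin : ∀ k ≤ i, s k = s i + (i - k)) (hlt : ∀ k, i < k → k ≤ p → s k < s i) :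
    ∃ Γ', IsPureComplex K E Γ' p (fun k => if k ≤ i then s k + 1 else s k) := by
  obtain ⟨n, hn⟩ := h.bounded
  have hΓ := h.isLowerSet
  obtain ⟨e⟩ : Nonempty (Finset ℕ ↪ ℕ) := ⟨⟨_, Encodable.encode_injective⟩⟩
  set u : Finset ℕ → ℕ := fun τ => n + e τ with hu_def
  have hu : Function.Injective u := fun a b hab => e.injective (by simpa [hu_def] using hab)
  have hfresh : ∀ τ, ∀ σ ∈ Γ, u τ ∉ σ := by
    intro τ σ hσ hmem
    have := Finset.mem_range.1 (hn σ hσ hmem)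
    simp [hu_def] at this
  set T : Set (Finset ℕ) := {τ | τ ∈ Γ ∧ s i ≤ τ.card} with hT_def
  have hT : T.Finite := (Finset.finite_toSet (Finset.range n).powerset).subset
    fun τ hτ => Finset.mem_coe.2 (Finset.mem_powerset.2 (hn τ hτ.1))
  refine ⟨attachStars Γ u T, attachStars_isLowerSet hΓ, ?_, ?_, ?_⟩
  · refine ⟨n + ∑ τ ∈ hT.toFinset, (u τ + 1), ?_⟩
    rintro σ (hσ | ⟨τ, hτ, hmem, hσ⟩)
    · exact (hn σ hσ).trans (Finset.range_subset_range.2 (by omega))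
    · intro x hx
      rw [Finset.mem_range]
      by_cases hxu : x = u τ
      · have := Finset.single_le_sum (f := fun τ => u τ + 1) (fun _ _ => Nat.zero_le _)
          (hT.mem_toFinset.2 hτ)
        omega
      · have := Finset.mem_range.1 (hn _ (star_subset hΓ _ hσ) (Finset.mem_erase.2 ⟨hxu, hx⟩))
        omega
  · intro k ρ hk
    by_cases hρ : ρ ∈ attachStars Γ u T
    swap
    · exact exactAt_of_notMem (attachStars_isLowerSet hΓ) hρ
    by_cases hρΓ : ρ ∈ Γ
    · by_cases hcard : s i ≤ ρ.card
      · -- The apex over `ρ` makes the link of `ρ` a cone.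
        refine exactAt_attachStars hΓ hu hfresh hρΓ hT (T₀ := {ρ})
          (Set.singleton_subset_iff.2 ⟨hρΓ, hcard⟩) ?_ ?_
        · refine exactAt_of_cone (hfresh ρ ρ hρΓ) fun W _ _ hW => faceFamily_le fun hmem => ?_
          refine Or.inr ⟨ρ, rfl, by simp, ?_⟩
          have hmem' : ρ ∪ W ∈ Γ := by
            refine hmem.resolve_right ?_
            rintro ⟨τ, rfl, hτ, -⟩
            exact (Finset.mem_union.1 hτ).elim (hfresh _ _ hρΓ) hW
          change _ ∪ ρ ∈ Γ
          rw [Finset.union_insert, Finset.erase_insert (by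
            rw [Finset.mem_union]; exact fun h => h.elim (hfresh _ _ hρΓ) hW),
            Finset.union_eq_left.2 Finset.subset_union_left]
          exact hmem'
        · rintro τ ⟨hτΓ, hτ⟩ hτρ j rfl
          by_cases hsub : τ ⊆ ρ
          · refine exactAt_star_of_subset hsub (h.exactAt _ _ ?_)
            rintro ⟨hj, hcj⟩
            have hss := Finset.card_lt_card (hsub.ssubset_of_ne hτρ)
            have hji : j < i := by
              by_contra hji
              rcases (not_lt.1 hji).eq_or_lt with rfl | hlt'
              · omega
              · have := hlt j hlt' hj; omega
            have h1 := hlin j hji.le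
            have h2 := hlin (j + 1) hji
            refine hk ⟨by omega, ?_⟩
            rw [if_pos (by omega)]
            omega
          · exact exactAt_star_of_not_subset j hsub
      · refine exactAt_attachStars hΓ hu hfresh hρΓ hT (T₀ := ∅) (Set.empty_subset _) ?_ ?_
        · have : attachStars Γ u ∅ = Γ := by simp [attachStars]
          rw [this]
          refine h.exactAt _ _ ?_
          rintro ⟨hkp, hck⟩
          have : ¬ k ≤ i := fun hki => by have := hlin k hki; omega
          exact hk ⟨hkp, by rw [if_neg this, hck]⟩
        · rintro τ ⟨hτΓ, hτ⟩ - j -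
          exact exactAt_star_of_not_subset j fun hsub => hcard (hτ.trans (Finset.card_le_card hsub))
    · obtain ⟨τ, ⟨hτΓ, hτ⟩, hmem, hστ⟩ := hρ.resolve_left hρΓ
      set ρ₀ := ρ.erase (u τ) with hρ₀
      have hρeq : ρ = insert (u τ) ρ₀ := (Finset.insert_erase hmem).symm
      have hρ₀Γ := star_subset hΓ _ hστ
      -- The link of `ρ₀ ∪ {u τ}` is the link of `ρ₀` in the star of `τ`.
      have hlink : ExactAt (faceFamily K E (star Γ τ)) k ρ₀ →
          ExactAt (faceFamily K E (attachStars Γ u T)) k ρ := by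
        intro hE
        have hcell : ∀ j, chains (faceFamily K E (star Γ τ)) j ρ₀
            = chains (faceFamily K E (attachStars Γ u T)) j ρ := by
          intro j
          ext f
          rw [mem_chains_faceFamily, mem_chains_faceFamily]
          refine forall_congr' fun W => imp_congr_right fun _ => and_congr_right fun _ => ?_
          rw [hρeq, Finset.disjoint_insert_left]
          constructor
          · rintro ⟨h1, h2⟩
            have huW : u τ ∉ W := fun hW =>
              hfresh τ _ (star_subset hΓ _ h2) (Finset.mem_union_right _ hW)
            refine ⟨⟨huW, h1⟩, Or.inr ⟨τ, ⟨hτΓ, hτ⟩, by simp, ?_⟩⟩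
            rwa [Finset.insert_union, Finset.erase_insert
              (hfresh τ _ (star_subset hΓ _ h2))]
          · rintro ⟨⟨h1, h2⟩, h3⟩
            refine ⟨h2, ?_⟩
            have hu' : u τ ∈ insert (u τ) ρ₀ ∪ W := by simp
            rcases h3 with h3 | ⟨τ', -, hτ', h3⟩
            · exact absurd hu' (hfresh τ _ h3)
            · have : u τ = u τ' := by
                by_contra hne
                exact hfresh τ _ (star_subset hΓ _ h3) (Finset.mem_erase.2 ⟨hne, hu'⟩)
              rw [← hu this, Finset.insert_union, Finset.erase_insert (by
                rw [Finset.mem_union]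
                exact fun h => h.elim (hfresh τ _ hρ₀Γ) h1)] at h3
              exact h3
        intro f hf
        rw [← hcell] at hf ⊢
        exact hE f hf
      refine hlink ?_
      by_cases hsub : τ ⊆ ρ₀
      · refine exactAt_star_of_subset hsub (h.exactAt _ _ ?_)
        rintro ⟨hkp, hck⟩
        have hle := hτ.trans (Finset.card_le_card hsub)
        have hki : k ≤ i := by
          by_contra hki
          have := hlt k (not_le.1 hki) hkp
          omega
        refine hk ⟨hkp, ?_⟩
        rw [if_pos hki, ← hck, hρ₀, Finset.card_erase_add_one hmem]
      · exact exactAt_star_of_not_subset k hsub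
  · obtain ⟨ρ, hρ⟩ := h.not_exactAt
    refine ⟨ρ, fun hE => hρ ?_⟩
    have hρΓ : ρ ∈ Γ := by
      by_contra hρΓ
      exact hρ (exactAt_of_notMem hΓ hρΓ)
    have hcard : ρ.card = s p := by
      by_contra hc
      exact hρ (h.exactAt _ _ fun hh => hc hh.2)
    refine exactAt_of_attachStars hΓ hu hfresh hρΓ hT hE ?_
    rintro τ ⟨hτΓ, hτ⟩
    refine exactAt_star_of_not_subset p fun hsub => ?_
    have h1 := Finset.card_le_card hsub
    have h2 := hlt p hi le_rfl
    omega

/-- For positive integers `e 0, …, e (p - 1)` there is a pure complex whose shifts have the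
differences `s k - s (k + 1) = e k`. -/
lemma exists_isPureComplex [Nontrivial E] (p : ℕ) (e : ℕ → ℕ) (he : ∀ k, 0 < e k) :
    ∃ Γ, IsPureComplex K E Γ p (fun k => ∑ l ∈ Finset.Ico k p, e l) := by
  -- The differences are raised from `1` to their values one at a time, the last one first.
  suffices H : ∀ j ≤ p, ∀ e : ℕ → ℕ, (∀ k, 0 < e k) → (∀ k < j, e k = 1) →
      ∃ Γ, IsPureComplex K E Γ p (fun k => ∑ l ∈ Finset.Ico k p, e l) from
    H 0 (Nat.zero_le _) e he (by simp)
  intro j hj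
  induction hj using Nat.decreasingInduction with
  | self =>
    intro e _ h1
    refine ⟨{σ | σ ⊂ Finset.range (p + 1)}, ?_⟩
    convert isPureComplex_boundary (K := K) (E := E) p using 2 with k
    rw [Finset.sum_congr rfl (fun l hl => h1 l (Finset.mem_Ico.1 hl).2)]
    simp
  | of_succ j hj ih =>
    intro e he h1
    obtain ⟨a, ha⟩ : ∃ a, e j = a + 1 := ⟨e j - 1, by have := he j; omega⟩
    induction a generalizing e with
    | zero =>
      refine ih e he fun k hk => ?_
      rcases (Nat.lt_succ_iff.1 hk).eq_or_lt with rfl | hk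
      · simpa using ha
      · exact h1 k hk
    | succ a iha =>
      set e' : ℕ → ℕ := Function.update e j (a + 1) with he'
      have hpos : ∀ k, 0 < e' k := by
        intro k
        by_cases hk : k = j
        · subst hk; simp [he']
        · rw [he', Function.update_of_ne hk]; exact he k
      obtain ⟨Γ, hΓ⟩ := iha e' hpos
        (fun k hk => by rw [he', Function.update_of_ne hk.ne]; exact h1 k hk) (by simp [he'])
      have hlin : ∀ k ≤ j, ∑ l ∈ Finset.Ico k p, e' l = ∑ l ∈ Finset.Ico j p, e' l + (j - k) := by
        intro k hk
        rw [← Finset.sum_Ico_consecutive _ hk hj.le, add_comm]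
        congr 1
        rw [Finset.sum_congr rfl (g := fun _ => 1)]
        · simp
        · intro l hl
          have := (Finset.mem_Ico.1 hl).2
          rw [he', Function.update_of_ne this.ne]
          exact h1 l this
      have hlt : ∀ k, j < k → k ≤ p →
          ∑ l ∈ Finset.Ico k p, e' l < ∑ l ∈ Finset.Ico j p, e' l := by
        intro k hjk hkp
        rw [← Finset.sum_Ico_consecutive _ hjk.le hkp]
        have : 0 < ∑ l ∈ Finset.Ico j k, e' l :=
          Finset.sum_pos (fun l _ => hpos l) ⟨j, by simp [hjk]⟩
        omega
      obtain ⟨Γ', hΓ'⟩ := hΓ.raise hj hlin hlt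
      refine ⟨Γ', ?_⟩
      convert hΓ' using 2 with k
      split_ifs with hk
      · have hm : j ∈ Finset.Ico k p := Finset.mem_Ico.2 ⟨hk, hj⟩
        rw [← Finset.add_sum_erase _ _ hm, ← Finset.add_sum_erase _ e' hm, ha,
          Finset.sum_congr rfl (g := e')]
        · simp [he']; omega
        · intro l hl
          rw [he', Function.update_of_ne (Finset.mem_erase.1 hl).1]
      · refine Finset.sum_congr rfl fun l hl => ?_
        rw [he', Function.update_of_ne]
        have := (Finset.mem_Ico.1 hl).1
        omega

end Construction

/-! ### Minimal generators and dimension shifting -/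

section Generators

variable {K E : Type*} [Field K] [AddCommGroup E] [Module K E]

/-- The part of `N ρ` that comes from larger sets. -/
def rad (N : Finset ℕ → Submodule K E) (ρ : Finset ℕ) : Submodule K E :=
  ⨆ v, ⨆ (_ : v ∉ ρ), N (insert v ρ)

lemma rad_le {N : Finset ℕ → Submodule K E} (hN : Antitone N) (ρ : Finset ℕ) : rad N ρ ≤ N ρ :=
  iSup₂_le fun _ _ => hN (Finset.subset_insert _ _)

lemma le_rad {N : Finset ℕ → Submodule K E} (hN : Antitone N) {ρ σ : Finset ℕ} (h : ρ ⊂ σ) :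
    N σ ≤ rad N ρ := by
  obtain ⟨v, hv, hvρ⟩ := Finset.exists_of_ssubset h
  exact (hN (Finset.insert_subset hv h.1)).trans (le_iSup₂_of_le v hvρ le_rfl)

/-- A minimal system of generators of a family `N` of subspaces: a basis element with label `σ`
is sent to a vector of `N σ`, which lies in `N ρ` for all `ρ ⊆ σ`. -/
structure Generators (N : Finset ℕ → Submodule K E) where
  /-- The index type of the generators. -/
  gen : Type
  /-- There are finitely many generators. -/
  fin : Fintype gen
  /-- The label of a generator. -/
  lab : gen → Finset ℕ
  /-- The vector that a generator stands for. -/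
  vec : gen → E
  vec_mem : ∀ g, vec g ∈ N (lab g)
  generates : ∀ ρ, ∀ e ∈ N ρ, ∃ c : gen → K, (∀ g, c g ≠ 0 → ρ ⊆ lab g) ∧
    ∑ g, c g • vec g = e
  minimal : ∀ ρ, ∀ c : gen → K, (∀ g, c g ≠ 0 → ρ ⊆ lab g) → ∑ g, c g • vec g ∈ rad N ρ →
    ∀ g, lab g = ρ → c g = 0

attribute [instance] Generators.fin

lemma exists_complement_rad {N : Finset ℕ → Submodule K E} (hN : Antitone N) (ρ : Finset ℕ) :
    ∃ B : Submodule K E, rad N ρ ⊔ B = N ρ ∧ Disjoint (rad N ρ) B := by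
  obtain ⟨B, hB⟩ := Submodule.exists_isCompl (rad N ρ)
  refine ⟨B ⊓ N ρ, ?_, hB.disjoint.mono_right inf_le_left⟩
  rw [← sup_inf_assoc_of_le _ (rad_le hN ρ), hB.sup_eq_top, top_inf_eq]

/-- A family of subspaces of a finite-dimensional space that vanishes outside the subsets of
`{0, …, n - 1}` has a minimal system of generators: collect bases of complements of `rad N ρ`
in `N ρ`. -/
lemma nonempty_generators [FiniteDimensional K E] {N : Finset ℕ → Submodule K E}
    (hN : Antitone N) {n : ℕ} (hn : ∀ ρ, ¬ ρ ⊆ Finset.range n → N ρ = ⊥) :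
    Nonempty (Generators N) := by
  choose B hB hdisj using exists_complement_rad hN
  have hBN : ∀ ρ, B ρ ≤ N ρ := fun ρ => le_sup_right.trans (hB ρ).le
  let G := Σ ρ : {ρ // ρ ∈ (Finset.range n).powerset}, Fin (Module.finrank K (B ρ))
  let lab : G → Finset ℕ := fun g => g.1
  let vec : G → E := fun g => (Module.finBasis K (B g.1) g.2 : B g.1)
  have hvec : ∀ g, vec g ∈ B (lab g) := fun g => (Module.finBasis K (B g.1) g.2).2
  have hvecN : ∀ g, vec g ∈ N (lab g) := fun g => hBN _ (hvec g)
  have hspan : ∀ m, ∀ ρ ⊆ Finset.range n, (Finset.range n \ ρ).card = m →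
      N ρ ≤ Submodule.span K (vec '' {g | ρ ⊆ lab g}) := by
    intro m
    induction m using Nat.strong_induction_on with
    | _ m ih =>
      intro ρ hρ hm
      rw [← hB ρ]
      refine sup_le (iSup₂_le fun v hv => ?_) fun b hb => ?_
      · by_cases hvn : v ∈ Finset.range n
        · refine (ih _ ?_ (insert v ρ) (Finset.insert_subset hvn hρ) rfl).trans
            (Submodule.span_mono (Set.image_mono fun g hg => ?_))
          · rw [← hm]
            refine Finset.card_lt_card (Finset.ssubset_iff_subset_ne.2 ⟨?_, fun h => ?_⟩)
            · exact Finset.sdiff_subset_sdiff subset_rfl (Finset.subset_insert _ _)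
            · have : v ∈ Finset.range n \ insert v ρ := h ▸ Finset.mem_sdiff.2 ⟨hvn, hv⟩
              simp at this
          · exact (Finset.subset_insert _ _).trans hg
        · rw [hn _ fun h => hvn (h (Finset.mem_insert_self _ _))]
          exact bot_le
      · have := (Module.finBasis K (B ρ)).sum_repr ⟨b, hb⟩
        have h2 := congrArg Subtype.val this
        rw [Submodule.coe_sum] at h2
        change _ = b at h2
        rw [← h2]
        refine Submodule.sum_mem _ fun i _ => ?_
        refine Submodule.smul_mem _ _ (Submodule.subset_span
          ⟨⟨⟨ρ, Finset.mem_powerset.2 hρ⟩, i⟩, Finset.Subset.refl ρ, rfl⟩)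
  refine ⟨⟨G, inferInstance, lab, vec, hvecN, ?_, ?_⟩⟩
  · intro ρ e he
    by_cases hρ : ρ ⊆ Finset.range n
    · refine Submodule.span_induction (p := fun e _ => ∃ c : G → K,
        (∀ g, c g ≠ 0 → ρ ⊆ lab g) ∧ ∑ g, c g • vec g = e) ?_ ?_ ?_ ?_ (hspan _ ρ hρ rfl he)
      · rintro _ ⟨g, hg, rfl⟩
        classical
        refine ⟨Pi.single g 1, fun g' hg' => ?_, ?_⟩
        · by_cases h : g' = g
          · exact h ▸ hg
          · exact absurd (Pi.single_eq_of_ne h _) hg'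
        · rw [Finset.sum_eq_single g]
          · simp
          · intro g' _ h; rw [Pi.single_eq_of_ne h, zero_smul]
          · simp
      · exact ⟨0, by simp, by simp⟩
      · rintro _ _ _ _ ⟨c, hc, rfl⟩ ⟨c', hc', rfl⟩
        refine ⟨c + c', fun g hg => ?_, by simp [add_smul, Finset.sum_add_distrib]⟩
        by_cases h : c g = 0
        · exact hc' g fun h' => hg (by simp [h, h'])
        · exact hc g h
      · rintro a _ _ ⟨c, hc, rfl⟩
        refine ⟨a • c, fun g hg => hc g fun h => hg (by simp [h]), ?_⟩
        simp [Finset.smul_sum, mul_smul]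
    · rw [hn ρ hρ, Submodule.mem_bot] at he
      exact ⟨0, by simp, by simp [he]⟩
  · rintro _ c hc hsum ⟨⟨ρ, hρ⟩, i⟩ rfl
    change ∀ g, c g ≠ 0 → ρ ⊆ lab g at hc
    change ∑ g, c g • vec g ∈ rad N ρ at hsum
    let b := Module.finBasis K (B ρ)
    have hsplit : ∑ g, c g • vec g = ∑ j, c ⟨⟨ρ, hρ⟩, j⟩ • (b j : E)
        + ∑ σ ∈ Finset.univ.erase (⟨ρ, hρ⟩ : {ρ // ρ ∈ (Finset.range n).powerset}),
          ∑ j, c ⟨σ, j⟩ • vec ⟨σ, j⟩ := by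
      rw [Fintype.sum_sigma, ← Finset.add_sum_erase _ _ (Finset.mem_univ ⟨ρ, hρ⟩)]
    have hrest : ∑ σ ∈ Finset.univ.erase (⟨ρ, hρ⟩ : {ρ // ρ ∈ (Finset.range n).powerset}),
          ∑ j, c ⟨σ, j⟩ • vec ⟨σ, j⟩ ∈ rad N ρ := by
      refine Submodule.sum_mem _ fun σ hσ => Submodule.sum_mem _ fun j _ => ?_
      by_cases h : c ⟨σ, j⟩ = 0
      · rw [h, zero_smul]; exact zero_mem _
      · refine Submodule.smul_mem _ _ (le_rad hN ?_ (hvecN ⟨σ, j⟩))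
        refine Finset.ssubset_iff_subset_ne.2 ⟨hc _ h, fun h' => ?_⟩
        exact (Finset.mem_erase.1 hσ).1 (Subtype.ext h'.symm)
    rw [hsplit, Submodule.add_mem_iff_left _ hrest] at hsum
    have hcoe : ∑ j, c ⟨⟨ρ, hρ⟩, j⟩ • (b j : E)
        = ((∑ j, c ⟨⟨ρ, hρ⟩, j⟩ • b j : B ρ) : E) := by
      rw [Submodule.coe_sum]; rfl
    rw [hcoe] at hsum
    have h0 := (Submodule.disjoint_def.1 (hdisj ρ)) _ hsum (Submodule.coe_mem _)
    exact (Fintype.linearIndependent_iff.1 b.linearIndependent) _ (Subtype.ext h0) i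

end Generators

section Syzygies

variable {K E : Type*} [Field K] [AddCommGroup E] [Module K E]

/-- The family of a free module with one basis element for each `g : G`, with label `lab g`. -/
def freeFamily (K : Type*) [Field K] {G : Type*} (lab : G → Finset ℕ) (ρ : Finset ℕ) :
    Submodule K (G → K) where
  carrier := {c | ∀ g, c g ≠ 0 → ρ ⊆ lab g}
  zero_mem' := by simp
  add_mem' := by
    intro c c' hc hc' g hg
    by_cases h : c g = 0
    · exact hc' g fun h' => hg (by simp [h, h'])
    · exact hc g h
  smul_mem' := fun a c hc g hg => hc g fun h => hg (by simp [h])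

lemma freeFamily_antitone {G : Type*} (lab : G → Finset ℕ) : Antitone (freeFamily K lab) :=
  fun _ _ h _ hc g hg => h.trans (hc g hg)

lemma bd_mapRange {F : Type*} [AddCommGroup F] (T : E →+ F) (f : Finset ℕ →₀ E) :
    bd (Finsupp.mapRange.addMonoidHom T f) = Finsupp.mapRange.addMonoidHom T (bd f) := by
  induction f using Finsupp.induction_linear with
  | zero => simp
  | add f g hf hg => rw [map_add, map_add, hf, hg, map_add, map_add]
  | single W e =>
    rw [bd_single, map_sum]
    simp only [map_zsmul, Finsupp.mapRange.addMonoidHom_apply, Finsupp.mapRange_single, bd_single]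

/-- A cycle of a free family is a boundary if its coefficients at the generators with label `ρ`
vanish: each other component can be coned off. -/
lemma exists_bd_eq_of_free {G : Type*} [Fintype G] {lab : G → Finset ℕ} {k : ℕ} {ρ : Finset ℕ}
    {f : Finset ℕ →₀ (G → K)} (hf : f ∈ chains (freeFamily K lab) k ρ) (hbd : bd f = 0)
    (h : ∀ g, lab g = ρ → ∀ W, f W g = 0) :
    ∃ q ∈ chains (freeFamily K lab) (k + 1) ρ, bd q = f := by
  classical
  let pr : G → (G → K) →+ (G → K) := fun g =>
    (LinearMap.single K (fun _ => K) g ∘ₗ LinearMap.proj g).toAddMonoidHom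
  have hpr : ∀ g c, pr g c = Pi.single g (c g) := fun g c => rfl
  let line : G → Finset ℕ → Submodule K (G → K) := fun g σ =>
    if σ ⊆ lab g then LinearMap.range (LinearMap.single K (fun _ : G => K) g) else ⊥
  have hmem : ∀ g σ x, σ ⊆ lab g → Pi.single g x ∈ line g σ := fun g σ x hσ => by
    simp only [line, if_pos hσ]; exact ⟨x, rfl⟩
  have hle : ∀ g σ, line g σ ≤ freeFamily K lab σ := by
    intro g σ
    simp only [line]
    split_ifs with hσ
    · rintro _ ⟨x, rfl⟩ g' hg'
      by_cases hgg : g' = g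
      · exact hgg ▸ hσ
      · exact absurd (Pi.single_eq_of_ne hgg _) hg'
    · exact bot_le
  have key : ∀ g, ∃ q ∈ chains (freeFamily K lab) (k + 1) ρ,
      bd q = Finsupp.mapRange.addMonoidHom (pr g) f := by
    intro g
    by_cases hv : ∃ v ∈ lab g, v ∉ ρ
    · obtain ⟨v, hvg, hvρ⟩ := hv
      have hex : ExactAt (line g) k ρ := by
        refine exactAt_of_cone hvρ fun W _ _ _ => ?_
        simp only [line]
        by_cases hW : ρ ∪ W ⊆ lab g
        · rw [if_pos hW, if_pos]
          rw [Finset.union_insert]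
          exact Finset.insert_subset hvg hW
        · rw [if_neg hW]; exact bot_le
      obtain ⟨q, hq, hqb⟩ := hex (Finsupp.mapRange.addMonoidHom (pr g) f) (by
          rw [mem_chains] at hf ⊢
          intro W hW
          rw [Finsupp.mapRange.addMonoidHom_apply, Finsupp.mapRange_apply, hpr] at hW ⊢
          have hne : f W g ≠ 0 := fun h0 => hW (by rw [h0, Pi.single_zero])
          obtain ⟨h1, h2, h3⟩ := hf W fun h0 => hne (by rw [h0]; rfl)
          exact ⟨h1, h2, hmem _ _ _ (h3 g hne)⟩) (by rw [bd_mapRange, hbd, map_zero])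
      refine ⟨q, ?_, hqb⟩
      rw [mem_chains] at hq ⊢
      exact fun W hW => ⟨(hq W hW).1, (hq W hW).2.1, hle _ _ (hq W hW).2.2⟩
    · refine ⟨0, zero_mem _, ?_⟩
      rw [map_zero, eq_comm]
      ext W : 1
      rw [Finsupp.mapRange.addMonoidHom_apply, Finsupp.mapRange_apply, hpr]
      suffices hz : f W g = 0 by rw [hz, Pi.single_zero]; rfl
      by_contra hne
      obtain ⟨-, -, h3⟩ := mem_chains.1 hf W fun h0 => hne (by rw [h0]; rfl)
      push Not at hv
      exact hne (h g (subset_antisymm hv (Finset.subset_union_left.trans (h3 g hne))) W)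
  choose q hq hqb using key
  refine ⟨∑ g, q g, Submodule.sum_mem _ fun g _ => hq g, ?_⟩
  rw [map_sum, Finset.sum_congr rfl fun g _ => hqb g]
  ext W : 1
  rw [Finsupp.finsetSum_apply]
  simp only [Finsupp.mapRange.addMonoidHom_apply, Finsupp.mapRange_apply, hpr]
  exact Finset.univ_sum_single (f W)

variable {N : Finset ℕ → Submodule K E} (S : Generators N)

/-- The family of relations between the generators. -/
def Generators.syzygies (ρ : Finset ℕ) : Submodule K (S.gen → K) :=
  freeFamily K S.lab ρ ⊓ LinearMap.ker (Fintype.linearCombination K S.vec)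

variable {S}

lemma Generators.mem_syzygies {ρ : Finset ℕ} {c : S.gen → K} : c ∈ S.syzygies ρ ↔
    (∀ g, c g ≠ 0 → ρ ⊆ S.lab g) ∧ ∑ g, c g • S.vec g = 0 := Iff.rfl

lemma Generators.syzygies_antitone : Antitone S.syzygies :=
  fun _ _ h => inf_le_inf_right _ (freeFamily_antitone _ h)

lemma Generators.sum_mem (hN : Antitone N) {ρ : Finset ℕ} {c : S.gen → K}
    (hc : c ∈ freeFamily K S.lab ρ) : ∑ g, c g • S.vec g ∈ N ρ := by
  refine Submodule.sum_mem _ fun g _ => ?_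
  by_cases h : c g = 0
  · rw [h, zero_smul]; exact zero_mem _
  · exact Submodule.smul_mem _ _ (hN (hc g h) (S.vec_mem g))

variable (S) in
/-- The map on chains induced by the map from the free family on the generators. -/
noncomputable def Generators.chainMap : (Finset ℕ →₀ (S.gen → K)) →+ (Finset ℕ →₀ E) :=
  Finsupp.mapRange.addMonoidHom (Fintype.linearCombination K S.vec).toAddMonoidHom

lemma Generators.chainMap_apply (f : Finset ℕ →₀ (S.gen → K)) (W : Finset ℕ) :
    S.chainMap f W = ∑ g, f W g • S.vec g := rfl

lemma Generators.chainMap_single (W : Finset ℕ) (c : S.gen → K) :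
    S.chainMap (Finsupp.single W c) = Finsupp.single W (∑ g, c g • S.vec g) := by
  simp [Generators.chainMap, Fintype.linearCombination_apply]

lemma Generators.bd_chainMap (f : Finset ℕ →₀ (S.gen → K)) :
    bd (S.chainMap f) = S.chainMap (bd f) := bd_mapRange _ _

lemma Generators.chainMap_mem (hN : Antitone N) {k : ℕ} {ρ : Finset ℕ}
    {f : Finset ℕ →₀ (S.gen → K)} (hf : f ∈ chains (freeFamily K S.lab) k ρ) :
    S.chainMap f ∈ chains N k ρ := by
  refine map_chains_mem S.chainMap _ (fun W e h1 h2 h3 => ?_) hf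
  rw [S.chainMap_single]
  exact single_mem_chains h1 h2 (S.sum_mem hN h3)

lemma Generators.exists_chainMap_eq {k : ℕ} {ρ : Finset ℕ} {f : Finset ℕ →₀ E}
    (hf : f ∈ chains N k ρ) :
    ∃ q ∈ chains (freeFamily K S.lab) k ρ, S.chainMap q = f := by
  refine chains_induction (p := fun f => ∃ q ∈ chains (freeFamily K S.lab) k ρ,
    S.chainMap q = f) ⟨0, zero_mem _, map_zero _⟩ ?_ ?_ hf
  · rintro _ _ ⟨q, hq, rfl⟩ ⟨q', hq', rfl⟩
    exact ⟨q + q', add_mem hq hq', map_add _ _ _⟩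
  · intro W e h1 h2 h3
    obtain ⟨c, hc, rfl⟩ := S.generates _ e h3
    exact ⟨_, single_mem_chains h1 h2 hc, S.chainMap_single W c⟩

lemma Generators.mem_chains_syzygies {k : ℕ} {ρ : Finset ℕ} {f : Finset ℕ →₀ (S.gen → K)} :
    f ∈ chains S.syzygies k ρ ↔ f ∈ chains (freeFamily K S.lab) k ρ ∧ S.chainMap f = 0 := by
  rw [mem_chains, mem_chains]
  constructor
  · refine fun h => ⟨fun W hW => ⟨(h W hW).1, (h W hW).2.1, (h W hW).2.2.1⟩, ?_⟩
    ext W : 1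
    by_cases hW : f W = 0
    · rw [S.chainMap_apply, hW]; simp
    · exact (S.mem_syzygies.1 (h W hW).2.2).2
  · rintro ⟨h, h0⟩ W hW
    exact ⟨(h W hW).1, (h W hW).2.1, (h W hW).2.2, DFunLike.congr_fun h0 W⟩

/-- In a chain of positive degree at `ρ`, generators with label `ρ` do not occur. -/
lemma apply_eq_zero_of_free {G : Type*} {lab : G → Finset ℕ} {k : ℕ} {ρ : Finset ℕ}
    {f : Finset ℕ →₀ (G → K)} (hf : f ∈ chains (freeFamily K lab) (k + 1) ρ) (g : G)
    (hg : lab g = ρ) (W : Finset ℕ) : f W g = 0 := by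
  by_contra hne
  obtain ⟨h1, h2, h3⟩ := mem_chains.1 hf W fun h0 => hne (by rw [h0]; rfl)
  have hW : W ⊆ ρ := hg ▸ Finset.subset_union_right.trans (h3 g hne)
  rw [disjoint_comm.1 h2 |>.eq_bot_of_le hW] at h1
  simp at h1

/-- Dimension shifting: the homology of the relations in degree `k` is that of the family in degree
`k + 1`. -/
lemma Generators.exactAt_syzygies_iff (hN : Antitone N) {k : ℕ} {ρ : Finset ℕ} :
    ExactAt S.syzygies k ρ ↔ ExactAt N (k + 1) ρ := by
  constructor
  · intro h z hz hbd
    obtain ⟨q, hq, rfl⟩ := S.exists_chainMap_eq hz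
    obtain ⟨y, hy, hyb⟩ := h (bd q) (S.mem_chains_syzygies.2
      ⟨bd_mem_chains (freeFamily_antitone _) hq, by rw [← S.bd_chainMap, hbd]⟩) (bd_bd q)
    obtain ⟨hy1, hy2⟩ := S.mem_chains_syzygies.1 hy
    obtain ⟨w, hw, hwb⟩ := exists_bd_eq_of_free (sub_mem hq hy1) (by rw [map_sub, hyb, sub_self])
      (apply_eq_zero_of_free (sub_mem hq hy1))
    refine ⟨S.chainMap w, S.chainMap_mem hN hw, ?_⟩
    rw [S.bd_chainMap, hwb, map_sub, hy2, sub_zero]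
  · intro h f hf hbd
    obtain ⟨hf1, hf2⟩ := S.mem_chains_syzygies.1 hf
    obtain ⟨q, hq, rfl⟩ := exists_bd_eq_of_free hf1 hbd (by
      cases k with
      | succ k => exact apply_eq_zero_of_free hf1
      | zero =>
        intro g hg W
        by_cases hW : f W = 0
        · rw [hW]; rfl
        · obtain ⟨h1, -, h3⟩ := mem_chains.1 hf W hW
          rw [Finset.card_eq_zero.1 h1, Finset.union_empty] at h3
          rw [Finset.card_eq_zero.1 h1]
          exact S.minimal ρ _ h3.1 (by rw [(S.mem_syzygies.1 h3).2]; exact zero_mem _) g hg)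
    obtain ⟨w, hw, hwb⟩ := h (S.chainMap q) (S.chainMap_mem hN hq)
      (by rw [S.bd_chainMap, hf2])
    obtain ⟨y, hy, rfl⟩ := S.exists_chainMap_eq hw
    rw [S.bd_chainMap] at hwb
    refine ⟨q - bd y, S.mem_chains_syzygies.2
      ⟨sub_mem hq (bd_mem_chains (freeFamily_antitone _) hy), ?_⟩, ?_⟩
    · rw [map_sub, hwb, sub_self]
    · rw [map_sub, bd_bd, sub_zero]

lemma Generators.vec_notMem_rad (g : S.gen) : S.vec g ∉ rad N (S.lab g) := by
  classical
  intro hrad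
  have hsum : ∑ g', (Pi.single g (1 : K) : S.gen → K) g' • S.vec g' = S.vec g := by
    rw [Finset.sum_eq_single g]
    · simp
    · intro g' _ h; rw [Pi.single_eq_of_ne h, zero_smul]
    · simp
  have := S.minimal (S.lab g) (Pi.single g 1) (fun g' hg' => by
    by_cases hgg : g' = g
    · rw [hgg]
    · exact absurd (Pi.single_eq_of_ne hgg _) hg') (by rw [hsum]; exact hrad) g rfl
  simp at this

lemma Generators.vec_ne_zero (g : S.gen) : S.vec g ≠ 0 := fun h =>
  S.vec_notMem_rad g (by rw [h]; exact zero_mem _)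

/-- There are no generators with label `ρ` if the homology of degree `0` at `ρ` vanishes. -/
lemma Generators.lab_ne {ρ : Finset ℕ} (h : ExactAt N 0 ρ) (g : S.gen) :
    S.lab g ≠ ρ := by
  rintro rfl
  have hmem : Finsupp.single ∅ (S.vec g) ∈ chains N 0 (S.lab g) :=
    single_mem_chains rfl (Finset.disjoint_empty_right _)
      (by rw [Finset.union_empty]; exact S.vec_mem g)
  obtain ⟨q, hq, hqb⟩ := h _ hmem (bd_eq_zero_of_mem_chains_zero hmem)
  have hrad : bd q ∅ ∈ rad N (S.lab g) := by
    refine map_chains_mem ((Finsupp.applyAddHom ∅).comp bd) _ (fun W e h1 h2 h3 => ?_) hq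
    obtain ⟨v, rfl⟩ := Finset.card_eq_one.1 h1
    have hv : v ∉ S.lab g := Finset.disjoint_singleton_right.1 h2
    rw [Finset.union_comm] at h3
    have : N (insert v (S.lab g)) ≤ rad N (S.lab g) := le_iSup₂_of_le v hv le_rfl
    simp only [AddMonoidHom.comp_apply, bd_single, Finset.sum_singleton,
      Finset.erase_singleton, map_zsmul, Finsupp.applyAddHom_apply, Finsupp.single_eq_same]
    exact zsmul_mem (this h3) _
  rw [hqb, Finsupp.single_eq_same] at hrad
  exact S.vec_notMem_rad g hrad

end Syzygies

/-! ### From families of subspaces to graded resolutions -/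

section Resolution

open MvPolynomial

variable {K : Type*} [Field K]

variable (K) in
/-- A stage of the construction of a resolution: a family `N` of subspaces of the free family on a
finite labelled set. It encodes the submodule of a free module that is to be resolved. -/
structure Stage (n : ℕ) where
  /-- The basis of the ambient free module. -/
  ι : Type
  /-- The basis is finite. -/
  fin : Fintype ι
  /-- The labels of the basis elements. -/
  lab : ι → Finset ℕ
  /-- The family of subspaces. -/
  N : Finset ℕ → Submodule K (ι → K)
  antitone : Antitone N
  bounded : ∀ ρ, ¬ ρ ⊆ Finset.range n → N ρ = ⊥
  le_free : ∀ ρ, N ρ ≤ freeFamily K lab ρ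

attribute [instance] Stage.fin

variable {n : ℕ}

/-- A chosen minimal system of generators of a stage. -/
noncomputable def Stage.gens (S : Stage K n) : Generators S.N :=
  (nonempty_generators S.antitone S.bounded).some

lemma Stage.lab_gens_subset (S : Stage K n) (g : S.gens.gen) :
    S.gens.lab g ⊆ Finset.range n := by
  by_contra h
  have := S.gens.vec_mem g
  rw [S.bounded _ h, Submodule.mem_bot] at this
  exact S.gens.vec_ne_zero g this

lemma Stage.subset_of_vec_ne_zero (S : Stage K n) {g : S.gens.gen} {h : S.ι}
    (hne : S.gens.vec g h ≠ 0) : S.gens.lab g ⊆ S.lab h :=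
  S.le_free _ (S.gens.vec_mem g) h hne

/-- The next stage: the relations between the generators. -/
noncomputable def Stage.next (S : Stage K n) : Stage K n where
  ι := S.gens.gen
  fin := S.gens.fin
  lab := S.gens.lab
  N := S.gens.syzygies
  antitone := S.gens.syzygies_antitone
  bounded := by
    intro ρ hρ
    rw [eq_bot_iff]
    intro c hc
    rw [Submodule.mem_bot]
    ext g
    by_contra hg
    exact hρ ((hc.1 g hg).trans (S.lab_gens_subset g))
  le_free := fun _ => inf_le_left

/-- The stages that arise from a given one. -/
noncomputable def Stage.seq (S : Stage K n) : ℕ → Stage K n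
  | 0 => S
  | i + 1 => (S.seq i).next

/-- The exponent of the squarefree monomial `∏ x_i`, `i ∉ σ`. -/
noncomputable def expo (n : ℕ) (σ : Finset ℕ) : Fin n →₀ ℕ :=
  Finsupp.equivFunOnFinite.symm fun x => if (x : ℕ) ∈ σ then 0 else 1

/-- The set of variables that do not occur in the monomial with exponent `w`. -/
def zeros (w : Fin n →₀ ℕ) : Finset ℕ :=
  (Finset.univ.filter fun x => w x = 0).map Fin.valEmbedding

lemma expo_apply (σ : Finset ℕ) (x : Fin n) : expo n σ x = if (x : ℕ) ∈ σ then 0 else 1 := rfl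

lemma expo_le_iff {σ : Finset ℕ} {w : Fin n →₀ ℕ} : expo n σ ≤ w ↔ zeros w ⊆ σ := by
  rw [Finsupp.le_def]
  constructor
  · intro h x hx
    obtain ⟨y, hy, rfl⟩ := Finset.mem_map.1 hx
    have hy0 : w y = 0 := (Finset.mem_filter.1 hy).2
    by_contra hσ
    have := h y
    rw [expo_apply, if_neg (by simpa using hσ), hy0] at this
    omega
  · intro h x
    rw [expo_apply]
    split_ifs with hx
    · exact Nat.zero_le _
    · by_contra hw
      exact hx (h (Finset.mem_map.2 ⟨x, by simp; omega, rfl⟩))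

lemma expo_anti {σ τ : Finset ℕ} (h : σ ⊆ τ) : expo n τ ≤ expo n σ := by
  rw [Finsupp.le_def]
  intro x
  rw [expo_apply, expo_apply]
  split_ifs with h1 h2 h2
  · omega
  · omega
  · exact absurd (h h2) h1
  · omega

lemma expo_range : expo n (Finset.range n) = 0 := by
  ext x
  simp [expo_apply]

lemma zeros_expo {σ : Finset ℕ} (h : σ ⊆ Finset.range n) : zeros (expo n σ) = σ := by
  ext x
  rw [zeros, Finset.mem_map]
  constructor
  · rintro ⟨y, hy, rfl⟩
    by_contra hx
    have hy' := (Finset.mem_filter.1 hy).2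
    rw [expo_apply, if_neg (by simpa using hx)] at hy'
    omega
  · intro hx
    refine ⟨⟨x, Finset.mem_range.1 (h hx)⟩, Finset.mem_filter.2 ⟨Finset.mem_univ _, ?_⟩, rfl⟩
    rw [expo_apply, if_pos hx]

lemma degree_expo {σ : Finset ℕ} (h : σ ⊆ Finset.range n) :
    (expo n σ).degree + σ.card = n := by
  have h1 : (expo n σ).degree = ((Finset.range n).filter (· ∉ σ)).card := by
    rw [Finsupp.degree_eq_sum, Finset.card_filter, Finset.sum_range]
    refine Finset.sum_congr rfl fun x _ => ?_
    rw [expo_apply]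
    split_ifs <;> simp_all
  have h2 : ((Finset.range n).filter (· ∈ σ)).card = σ.card := by
    congr 1
    ext x
    simp only [Finset.mem_filter]
    exact ⟨fun hx => hx.2, fun hx => ⟨h hx, hx⟩⟩
  have h3 := Finset.card_filter_add_card_filter_not (s := Finset.range n) (· ∈ σ)
  rw [Finset.card_range, h2] at h3
  omega

lemma monomial_expo (σ : Finset ℕ) (a : K) : monomial (expo n σ) a
    = C a * ∏ x ∈ Finset.univ.filter (fun x : Fin n => (x : ℕ) ∉ σ), X x := by
  rw [monomial_eq, Finsupp.prod_fintype _ _ (fun _ => pow_zero _), Finset.prod_filter]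
  congr 1
  refine Finset.prod_congr rfl fun x _ => ?_
  rw [expo_apply]
  split_ifs <;> simp_all

section Multidegrees

variable {ι : Type*} (lab : ι → Finset ℕ)

/-- The component of multidegree `w` of an element of a free module: the coordinate of the
basis element `b` is the coefficient of `x^w / x^(expo (lab b))`. -/
noncomputable def component (w : Fin n →₀ ℕ) (y : ι → MvPolynomial (Fin n) K) (b : ι) : K :=
  open Classical in if expo n (lab b) ≤ w then coeff (w - expo n (lab b)) (y b) else 0

/-- The element of multidegree `w` of a free module with given coordinates. -/
noncomputable def ofComponent (w : Fin n →₀ ℕ) (c : ι → K) (b : ι) : MvPolynomial (Fin n) K :=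
  monomial (w - expo n (lab b)) (c b)

lemma component_mem (w : Fin n →₀ ℕ) (y : ι → MvPolynomial (Fin n) K) :
    component lab w y ∈ freeFamily K lab (zeros w) := by
  intro b hb
  rw [← expo_le_iff (n := n)]
  by_contra h
  exact hb (if_neg h)

lemma ofComponent_zero (w : Fin n →₀ ℕ) :
    ofComponent lab w (0 : ι → K) = 0 := by
  ext b : 1
  simp [ofComponent]

lemma exists_sum_ofComponent [Fintype ι] (y : ι → MvPolynomial (Fin n) K) :
    ∃ s : Finset (Fin n →₀ ℕ), y = ∑ w ∈ s, ofComponent lab w (component lab w y) := by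
  classical
  refine ⟨Finset.univ.biUnion fun b => (y b).support.image (· + expo n (lab b)), ?_⟩
  ext b m
  rw [Finset.sum_apply, coeff_sum, Finset.sum_eq_single (m + expo n (lab b))]
  · simp [ofComponent, component]
  · intro w _ hw
    rw [ofComponent, coeff_monomial, component]
    split_ifs with h1 h2
    · exact absurd (by rw [← h1, tsub_add_cancel_of_le h2]) hw
    · rfl
    · rfl
  · intro h
    have : coeff m (y b) = 0 := by
      by_contra hc
      exact h (Finset.mem_biUnion.2 ⟨b, Finset.mem_univ _,
        Finset.mem_image.2 ⟨m, mem_support_iff.2 hc, rfl⟩⟩)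
    simp [ofComponent, component, this]

end Multidegrees

/-- The matrix, with monomial entries, of the map from the free module on the generators of a stage
to its ambient free module. -/
noncomputable def Stage.matrix (S : Stage K n) :
    Matrix S.ι S.gens.gen (MvPolynomial (Fin n) K) := fun h g =>
  monomial (expo n (S.gens.lab g) - expo n (S.lab h)) (S.gens.vec g h)

lemma Stage.linearCombination_matrix (S : Stage K n) (h : S.ι)
    (y : S.gens.gen → MvPolynomial (Fin n) K) :
    Fintype.linearCombination (MvPolynomial (Fin n) K) (S.matrix h) y = S.matrix.mulVec y h := by
  rw [Fintype.linearCombination_apply, Matrix.mulVec, dotProduct]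
  exact Finset.sum_congr rfl fun g _ => mul_comm _ _

lemma Stage.component_matrix_mulVec (S : Stage K n) (w : Fin n →₀ ℕ)
    (y : S.gens.gen → MvPolynomial (Fin n) K) :
    component S.lab w (S.matrix.mulVec y) = ∑ g, component S.gens.lab w y g • S.gens.vec g := by
  ext h
  rw [Finset.sum_apply, component]
  simp only [Pi.smul_apply, smul_eq_mul]
  split_ifs with hw
  · simp only [Matrix.mulVec, dotProduct, coeff_sum]
    refine Finset.sum_congr rfl fun g _ => ?_
    by_cases hv : S.gens.vec g h = 0
    · simp [Stage.matrix, hv]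
    · have hle := expo_anti (n := n) (S.subset_of_vec_ne_zero hv)
      rw [Stage.matrix, coeff_monomial_mul', component]
      by_cases hg : expo n (S.gens.lab g) ≤ w
      · rw [if_pos (tsub_le_tsub_right hg _), if_pos hg, tsub_tsub_tsub_cancel_right hle, mul_comm]
      · rw [if_neg, if_neg hg, zero_mul]
        intro h'
        refine hg ?_
        rw [← tsub_add_cancel_of_le hle, ← tsub_add_cancel_of_le hw]
        exact add_le_add_left h' _
  · rw [eq_comm]
    refine Finset.sum_eq_zero fun g _ => ?_
    by_cases hv : S.gens.vec g h = 0
    · rw [hv, mul_zero]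
    · rw [component, if_neg, zero_mul]
      exact fun h' => hw ((expo_anti (S.subset_of_vec_ne_zero hv)).trans h')

lemma Stage.matrix_mulVec_ofComponent (S : Stage K n) (w : Fin n →₀ ℕ) {c : S.gens.gen → K}
    (hc : c ∈ freeFamily K S.gens.lab (zeros w)) :
    S.matrix.mulVec (ofComponent S.gens.lab w c)
      = ofComponent S.lab w (∑ g, c g • S.gens.vec g) := by
  ext h : 1
  simp only [Matrix.mulVec, dotProduct, ofComponent, Stage.matrix, monomial_mul, Finset.sum_apply,
    Pi.smul_apply, smul_eq_mul, map_sum]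
  refine Finset.sum_congr rfl fun g _ => ?_
  by_cases hv : S.gens.vec g h = 0
  · simp [hv]
  by_cases hg : c g = 0
  · simp [hg]
  rw [mul_comm (c g), add_comm, tsub_add_tsub_cancel (expo_le_iff.2 (hc g hg))
    (expo_anti (S.subset_of_vec_ne_zero hv))]

/-- Exactness of the sequence of free modules of two consecutive stages, checked in each
multidegree. -/
lemma Stage.exact_matrix (S : Stage K n) :
    Function.Exact S.next.matrix.mulVecLin S.matrix.mulVecLin := by
  intro (y : S.gens.gen → _)
  change S.matrix.mulVec y = 0 ↔ ∃ z, S.next.matrix.mulVec z = y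
  constructor
  · intro hy
    obtain ⟨s, hs⟩ := exists_sum_ofComponent S.gens.lab y
    change y ∈ LinearMap.range S.next.matrix.mulVecLin
    rw [hs]
    refine Submodule.sum_mem _ fun w _ => ?_
    have hmem : component S.gens.lab w y ∈ S.next.N (zeros w) := by
      refine Generators.mem_syzygies.2 ⟨component_mem _ _ _, ?_⟩
      rw [← S.component_matrix_mulVec, hy]
      ext h
      simp [component]
    obtain ⟨c, hc, hsum⟩ := S.next.gens.generates _ _ hmem
    refine ⟨ofComponent S.next.gens.lab w c, ?_⟩
    rw [Matrix.mulVecLin_apply, S.next.matrix_mulVec_ofComponent w hc, hsum]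
    rfl
  · rintro ⟨z, rfl⟩
    obtain ⟨s, hs⟩ := exists_sum_ofComponent S.next.gens.lab z
    change (S.matrix.mulVecLin ∘ₗ S.next.matrix.mulVecLin) z = 0
    rw [hs, map_sum]
    refine Finset.sum_eq_zero fun w _ => ?_
    have hc := component_mem S.next.gens.lab w z
    have hc' := S.next.gens.sum_mem S.next.antitone hc
    refine (congrArg S.matrix.mulVec (S.next.matrix_mulVec_ofComponent w hc)).trans ?_
    refine (S.matrix_mulVec_ofComponent w (S.next.le_free _ hc')).trans ?_
    rw [(Generators.mem_syzygies.1 hc').2, ofComponent_zero]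

/-- The initial stage: the Alexander dual of `Γ`, as an ideal in the free module of rank one. -/
noncomputable def initialStage (K : Type*) [Field K] {Γ : Set (Finset ℕ)} (hΓ : IsLowerSet Γ)
    {n : ℕ} (hn : ∀ σ ∈ Γ, σ ⊆ Finset.range n) : Stage K n where
  ι := Unit
  fin := inferInstance
  lab := fun _ => Finset.range n
  N := faceFamily K (Unit → K) Γ
  antitone := faceFamily_antitone hΓ
  bounded := fun ρ hρ => faceFamily_of_notMem fun h => hρ (hn ρ h)
  le_free := by
    intro ρ c hc g hg
    rcases mem_faceFamily.1 hc with rfl | h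
    · exact absurd rfl hg
    · exact hn ρ h

/-- The simplicial complex on `{0, …, n - 1}` whose nonfaces are the complements of the members
of `Γ`. -/
def dualComplex {Γ : Set (Finset ℕ)} (hΓ : IsLowerSet Γ) (n : ℕ) : Complex n where
  carrier := {s | sᶜ.map Fin.valEmbedding ∉ Γ}
  lower' := fun _ _ h h' h'' =>
    h' (hΓ (Finset.map_subset_map.2 (Finset.compl_subset_compl.2 h)) h'')

lemma notMem_dualComplex {Γ : Set (Finset ℕ)} (hΓ : IsLowerSet Γ) {n : ℕ} {s : Finset (Fin n)} :
    s ∉ dualComplex hΓ n ↔ sᶜ.map Fin.valEmbedding ∈ Γ := by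
  change ¬ (sᶜ.map Fin.valEmbedding ∉ Γ) ↔ _
  exact not_not

lemma map_compl_filter_notMem_subset (σ : Finset ℕ) :
    ((Finset.univ.filter fun x : Fin n => (x : ℕ) ∉ σ)ᶜ).map Fin.valEmbedding ⊆ σ := by
  intro x hx
  obtain ⟨y, hy, rfl⟩ := Finset.mem_map.1 hx
  simpa using hy

lemma filter_notMem_map_compl (s : Finset (Fin n)) :
    (Finset.univ.filter fun x : Fin n => (x : ℕ) ∉ sᶜ.map Fin.valEmbedding) = s := by
  ext x
  simp [Fin.val_inj]

lemma span_matrix_initialStage {Γ : Set (Finset ℕ)} (hΓ : IsLowerSet Γ)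
    {n : ℕ} (hn : ∀ σ ∈ Γ, σ ⊆ Finset.range n) :
    Ideal.span (Set.range ((initialStage K hΓ hn).matrix ())) =
      stanleyReisnerIdeal K (dualComplex hΓ n) := by
  set S := initialStage K hΓ hn with hS
  have hmat : ∀ g, S.matrix () g = monomial (expo n (S.gens.lab g)) (S.gens.vec g ()) := by
    intro g
    change monomial (_ - expo n (Finset.range n)) _ = _
    rw [expo_range, tsub_zero]
  refine le_antisymm (Ideal.span_le.2 ?_) (Ideal.span_le.2 ?_)
  · rintro _ ⟨g, rfl⟩
    rw [hmat, monomial_expo]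
    refine Ideal.mul_mem_left _ _ (Ideal.subset_span ⟨_, ?_, rfl⟩)
    rw [notMem_dualComplex]
    refine hΓ (map_compl_filter_notMem_subset _) ?_
    exact (mem_faceFamily.1 (S.gens.vec_mem g)).resolve_left (S.gens.vec_ne_zero g)
  · rintro _ ⟨s, hs, rfl⟩
    rw [notMem_dualComplex] at hs
    set σ := sᶜ.map Fin.valEmbedding with hσ
    obtain ⟨c, hc, hsum⟩ := S.gens.generates σ (fun _ => 1) (mem_faceFamily.2 (Or.inr hs))
    have key := S.matrix_mulVec_ofComponent (expo n σ) (c := c)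
      (by rw [zeros_expo (hn σ hs)]; exact hc)
    rw [hsum] at key
    have hprod : ∏ i ∈ s, X i = ∑ g, S.matrix () g * ofComponent S.gens.lab (expo n σ) c g := by
      have h1 := congrFun key ()
      have h2 : ofComponent S.lab (expo n σ) (fun _ => (1 : K)) () = ∏ i ∈ s, X i := by
        change monomial (_ - expo n (Finset.range n)) _ = _
        rw [expo_range, tsub_zero, monomial_expo, filter_notMem_map_compl, C_1, one_mul]
      rw [← h2, ← h1]
      rfl
    rw [SetLike.mem_coe, hprod]
    exact Ideal.sum_mem _ fun g _ => Ideal.mul_mem_right _ _ (Ideal.subset_span ⟨g, rfl⟩)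

variable {Γ : Set (Finset ℕ)} {p : ℕ} {s : ℕ → ℕ}

/-- Purity passes to the syzygies: the stages of the resolution have homology where the shifted
type allows it. -/
lemma exactAt_seq (S : Stage K n)
    (hS : ∀ k ρ, ¬ (k ≤ p ∧ ρ.card = s k) → ExactAt S.N k ρ) (i k : ℕ) (ρ : Finset ℕ)
    (h : ¬ (k + i ≤ p ∧ ρ.card = s (k + i))) : ExactAt (S.seq i).N k ρ := by
  induction i generalizing k with
  | zero => exact hS k ρ h
  | succ i ih =>
    refine (Generators.exactAt_syzygies_iff (S.seq i).antitone).2 (ih (k + 1) ?_)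
    rwa [show k + 1 + i = k + (i + 1) by ring]

lemma not_exactAt_seq (S : Stage K n) {ρ : Finset ℕ} (h : ¬ ExactAt S.N p ρ) {i : ℕ}
    (hi : i ≤ p) : ¬ ExactAt (S.seq i).N (p - i) ρ := by
  induction i with
  | zero => exact h
  | succ i ih =>
    intro h'
    have := (Generators.exactAt_syzygies_iff (S.seq i).antitone).1 h'
    rw [show p - (i + 1) + 1 = p - i by omega] at this
    exact ih (by omega) this

lemma Stage.nonempty_gen (S : Stage K n) {k : ℕ} {ρ : Finset ℕ} (h : ¬ ExactAt S.N k ρ) :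
    Nonempty S.gens.gen := by
  by_contra hemp
  rw [not_nonempty_iff] at hemp
  refine h fun f hf _ => ⟨0, zero_mem _, ?_⟩
  rw [map_zero]
  ext W : 1
  by_contra hW
  obtain ⟨-, -, h3⟩ := mem_chains.1 hf W (Ne.symm hW)
  obtain ⟨c, -, hc⟩ := S.gens.generates _ _ h3
  rw [Finset.univ_eq_empty, Finset.sum_empty] at hc
  exact hW hc

/-- The ideal whose squarefree generators are the complements of the faces of a pure complex `Γ`
has a pure minimal resolution. -/
theorem exists_minimalResolution (h : IsPureComplex K (Unit → K) Γ p s)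
    (hs : ∀ i < p, s (i + 1) < s i) :
    ∃ (n : ℕ) (Δ : Complex n) (F : MinimalResolution (stanleyReisnerIdeal K Δ)),
      (∀ i g, i ≤ p ∧ F.deg i g = n - s i) ∧ ∀ i ≤ p, Nonempty (F.gen i) ∧ s i ≤ n := by
  obtain ⟨n, hn⟩ := h.bounded
  set S := initialStage K h.isLowerSet hn with hS
  have hlab : ∀ i (g : (S.seq i).gens.gen), i ≤ p ∧ ((S.seq i).gens.lab g).card = s i := by
    intro i g
    by_contra hcon
    refine (S.seq i).gens.lab_ne (exactAt_seq S h.exactAt i 0 _ ?_) g rfl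
    rwa [zero_add]
  have hdeg : ∀ i (g : (S.seq i).gens.gen),
      (expo n ((S.seq i).gens.lab g)).degree = n - s i := by
    intro i g
    have := degree_expo ((S.seq i).lab_gens_subset g)
    rw [(hlab i g).2] at this
    omega
  have hle : ∀ i (_ : (S.seq i).gens.gen), s i ≤ n := by
    intro i g
    rw [← (hlab i g).2]
    simpa using Finset.card_le_card ((S.seq i).lab_gens_subset g)
  let F : MinimalResolution (stanleyReisnerIdeal K (dualComplex h.isLowerSet n)) :=
    { gen := fun i => (S.seq i).gens.gen
      fin := fun i => (S.seq i).gens.fin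
      deg := fun i _ => n - s i
      aug := S.matrix ()
      diff := fun i => (S.seq (i + 1)).matrix
      aug_homogeneous := by
        intro g
        refine isHomogeneous_monomial _ ?_
        change (_ - expo n (Finset.range n)).degree = _
        rw [expo_range, tsub_zero]
        exact hdeg 0 g
      diff_homogeneous := by
        intro i a g
        by_cases hv : (S.seq (i + 1)).gens.vec g a = 0
        · left
          simp [Stage.matrix, hv]
        · right
          have hexp := expo_anti (n := n) ((S.seq (i + 1)).subset_of_vec_ne_zero hv)
          refine ⟨(expo n ((S.seq (i + 1)).gens.lab g)
            - expo n ((S.seq (i + 1)).lab a)).degree, ?_, isHomogeneous_monomial _ rfl⟩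
          rw [← hdeg (i + 1) g, ← hdeg i a]
          change (expo n ((S.seq (i + 1)).lab a)).degree + _ = _
          rw [← map_add, add_tsub_cancel_of_le hexp]
      span_aug := span_matrix_initialStage h.isLowerSet hn
      exact_zero := by
        intro y
        have hy := S.linearCombination_matrix () y
        exact ⟨fun h0 => (S.exact_matrix y).1 (funext fun _ => hy.symm.trans h0),
          fun h0 => hy.trans (congrFun ((S.exact_matrix y).2 h0) ())⟩
      exact_succ := fun i => (S.seq (i + 1)).exact_matrix
      minimal := by
        intro i a g
        rw [← Set.image_univ, mem_ideal_span_X_image]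
        intro m hm
        have hm' := support_monomial_subset hm
        rw [Finset.mem_singleton] at hm'
        by_cases hv : (S.seq (i + 1)).gens.vec g a = 0
        · exact absurd hm (by simp [Stage.matrix, hv])
        -- The degrees of the two basis elements differ, so the entry is not a constant.
        have hexp := expo_anti (n := n) ((S.seq (i + 1)).subset_of_vec_ne_zero hv)
        have hne : m ≠ 0 := by
          intro h0
          rw [h0] at hm'
          have heq := le_antisymm hexp (tsub_eq_zero_iff_le.1 hm'.symm)
          have h1 := hdeg (i + 1) g
          have h2 : (expo n ((S.seq (i + 1)).lab a)).degree = n - s i := hdeg i a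
          rw [← heq, h2] at h1
          have h3 := hs i (hlab (i + 1) g).1
          have h4 : s i ≤ n := hle i a
          omega
        obtain ⟨x, hx⟩ := Finsupp.ne_iff.1 hne
        exact ⟨x, Set.mem_univ _, hx⟩ }
  refine ⟨n, _, F, fun i g => ⟨(hlab i g).1, rfl⟩, fun i hi => ?_⟩
  obtain ⟨ρ, hρ⟩ := h.not_exactAt
  have hne := (S.seq i).nonempty_gen (not_exactAt_seq S hρ hi)
  exact ⟨hne, hle i hne.some⟩

end Resolution

end PureBetti

theorem theorem1p2 (K : Type*) [Field K] (p : ℕ) (d : Fin p → ℕ) (hd : ∀ k, 0 < d k) :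
    ∃ (n : ℕ) (Δ : PureBetti.Complex n) (β : ℕ → ℕ → ℕ),
      PureBetti.IsBettiDiagram (PureBetti.stanleyReisnerIdeal K Δ) β ∧
        PureBetti.IsPure β ∧ PureBetti.HasDegreeType β d := by
  set e : ℕ → ℕ := fun k => if h : k < p then d ⟨k, h⟩ else 1 with he
  have hpos : ∀ k, 0 < e k := by
    intro k
    simp only [he]
    split_ifs
    · exact hd _
    · exact one_pos
  set s : ℕ → ℕ := fun k => ∑ l ∈ Finset.Ico k p, e l with hs
  have hstep : ∀ k < p, s k = e k + s (k + 1) := fun k hk =>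
    Finset.sum_eq_sum_Ico_succ_bot hk e
  obtain ⟨Γ, hΓ⟩ := PureBetti.exists_isPureComplex (K := K) (E := Unit → K) p e hpos
  obtain ⟨n, Δ, F, hdeg, hne⟩ := PureBetti.exists_minimalResolution (s := s) hΓ
    (fun i hi => by have := hstep i hi; have := hpos i; omega)
  have hbetti : ∀ i j, F.betti i j ≠ 0 ↔ i ≤ p ∧ n - s i = j := by
    intro i j
    have := F.fin i
    rw [PureBetti.MinimalResolution.betti, Nat.card_ne_zero]
    constructor
    · rintro ⟨⟨g, rfl⟩, -⟩
      exact ⟨(hdeg i g).1, (hdeg i g).2.symm⟩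
    · rintro ⟨hi, rfl⟩
      obtain ⟨g⟩ := (hne i hi).1
      exact ⟨⟨g, (hdeg i g).2⟩, inferInstance⟩
  refine ⟨n, Δ, F.betti, ⟨F, fun _ _ => rfl⟩, ?_, fun k => n - s k, ?_, ?_⟩
  · intro i j j' hj hj'
    rw [hbetti] at hj hj'
    exact hj.2.symm.trans hj'.2
  · intro i j
    rw [hbetti]
    constructor
    · rintro ⟨hi, rfl⟩
      exact ⟨⟨i, by omega⟩, rfl, rfl⟩
    · rintro ⟨k, rfl, rfl⟩
      exact ⟨by omega, rfl⟩
  · intro k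
    have h1 := hstep k k.2
    have h2 := (hne k k.2.le).2
    have h3 : e k = d k := by simp [he]
    simp only [Fin.val_succ, Fin.val_castSucc]
    omega
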